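/- Notation. For a partial function $g:[N]\rightharpoonup\{0,1\}$ let $U_g$ be the uniform distribution on the $x\in\{0,1\}^N$ with $x_j=g(j)$ for all $j\in\mathrm{dom}(g)$. For $f:\{0,1\}^N\to\{0,1\}$ and a distribution $D$ on $\{0,1\}^N$, let $\mathrm{Var}_D(f)=\Pr_{x,y\sim D}[f(x)\neq f(y)]$ with $x,y$ independent; this equals $2\,(\mathbb E[f(D)^2]-\mathbb E[f(D)]^2)$, so an upper bound on it is also an upper bound on the usual variance $\mathbb E[f(D)^2]-\mathbb E[f(D)]^2$. For $F:\{0,1\}^N\to\{0,1\}^L$ and $t\in[L]$, $F_t$ denotes the $t$-th output bit of $F$. Theorem. (1) Let $N,L,q$ be natural numbers and let $F:\{0,1\}^N\to\{0,1\}^L$ be such that every $F_t$, $t\in[L]$, is computable by a decision tree of depth at most $q$. Then for every real $\varepsilon>0$ there are a natural number $m\le Lq^2/\varepsilon$ and a partial function $g:[N]\rightharpoonup\{0,1\}$ with $|\mathrm{dom}(g)|\le m$ such that $\mathrm{Var}_{U_g}(F_t)\le\varepsilon$ for every $t\in[L]$. (2) Moreover, there are a single randomized algorithm $\mathsf A$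 with oracle access to $F$, polynomials $P$ and $R$, and a constant $C$, such that the following holds for all $N,L,q$, all $F$ as in (1), and all rational $\varepsilon,\delta>0$. On input $N,L,q,\varepsilon,\delta$ and with oracle $F$, for every outcome of its coin tosses, $\mathsf A$ halts within $R(N+L+q+1/\varepsilon+1/\delta)$ steps and makes at most $LN\cdot P\big(q/(\delta\varepsilon)\big)$ queries to $F$; and with probability at least $1-\delta$ it outputs a partial function $g:[N]\rightharpoonup\{0,1\}$ with $\mathrm{Var}_{U_g}(F_t)\le\varepsilon$ for every $t\in[L]$ and $|\mathrm{dom}(g)|\le C\cdot Lq^2/(\varepsilon\delta)$. Here an algorithm is a program for a random access machine on natural numbers, with unit-cost addition, truncated subtraction, indirect addressing, tests, fair coin flips and oracle queries. -/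

import Mathlib

/-! ### Decision trees -/

/-- Binary decision trees querying the coordinates of a point of `{0,1}^N`. -/
inductive DTree (N : ℕ) : Type
  | leaf (b : Bool) : DTree N
  | node (i : Fin N) (ifFalse ifTrue : DTree N) : DTree N

namespace DTree

/-- The label of the leaf reached by the unique root-to-leaf path consistent with `x`. -/
def eval {N : ℕ} : DTree N → (Fin N → Bool) → Bool
  | leaf b, _ => b
  | node i t₀ t₁, x => if x i then t₁.eval x else t₀.eval x

/-- Depth: the maximal number of queries on a path. -/
def depth {N : ℕ} : DTree N → ℕ
  | leaf _ => 0
  | node _ t₀ t₁ => max t₀.depth t₁.depth + 1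

/-- `f` is computable by a decision tree of depth at most `q`. -/
def Computes {N : ℕ} (q : ℕ) (f : (Fin N → Bool) → Bool) : Prop :=
  ∃ T : DTree N, T.depth ≤ q ∧ ∀ x, T.eval x = f x

end DTree

/-! ### Partial assignments, semi-uniform distributions, variance -/

/-- Partial functions from `[N]` to `{0,1}`. -/
abbrev PartialAssignment (N : ℕ) : Type := Fin N → Option Bool

namespace PartialAssignment

/-- The set of coordinates on which `g` is defined. -/
def dom {N : ℕ} (g : PartialAssignment N) : Finset (Fin N) :=
  Finset.univ.filter fun j => (g j).isSome

/-- `x j = g j` for every `j ∈ dom g`. -/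
def Agrees {N : ℕ} (g : PartialAssignment N) (x : Fin N → Bool) : Prop :=
  ∀ j : Fin N, ∀ b : Bool, g j = some b → x j = b

open Classical in
/-- The semi-uniform distribution `U_g`, as a probability mass function. -/
noncomputable def unif {N : ℕ} (g : PartialAssignment N) (x : Fin N → Bool) : ℝ :=
  if g.Agrees x then 1 / 2 ^ (N - g.dom.card) else 0

end PartialAssignment

/-- Expectation of `f` under the distribution with probability mass function `D`. -/
noncomputable def expect {N : ℕ} (D f : (Fin N → Bool) → ℝ) : ℝ :=
  ∑ x, D x * f x

/-- `E[f(D)^2] - E[f(D)]^2`, for a `0/1`-valued function `f`. -/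
noncomputable def variance01 {N : ℕ} (D : (Fin N → Bool) → ℝ) (f : (Fin N → Bool) → Bool) : ℝ :=
  expect D (fun x => (if f x then (1 : ℝ) else 0) ^ 2) -
    (expect D fun x => if f x then (1 : ℝ) else 0) ^ 2

/-- `Pr[f(x) ≠ f(y)]` for independent `x, y ∼ D`. -/
noncomputable def disagreement {N : ℕ} (D : (Fin N → Bool) → ℝ)
    (f : (Fin N → Bool) → Bool) : ℝ :=
  ∑ x, ∑ y, if f x ≠ f y then D x * D y else 0

/-- Every output bit of `F` has variance at most `ε` under `U_g`. For a `0/1`-valued function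
`Pr[f(x) ≠ f(y)]` is twice `E[f^2] - E[f]^2`; both are called the variance, and both are
required to be at most `ε`. -/
def SmallVariance {N L : ℕ} (F : (Fin N → Bool) → (Fin L → Bool)) (ε : ℝ)
    (g : PartialAssignment N) : Prop :=
  ∀ t : Fin L, variance01 g.unif (fun x => F x t) ≤ ε ∧
    disagreement g.unif (fun x => F x t) ≤ ε

/-! ### Randomized random access machines with an oracle

A program is one finite command. It works on registers and an addressable memory, both holding
natural numbers, on a tape of random bits, and on an oracle `F : {0,1}^N → {0,1}^L`. Every command
costs one step. Arithmetic is restricted to addition and truncated subtraction, so that a step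
lengthens the numbers in use by at most a constant number of bits; hence polynomially many steps
are the same as polynomial time on a Turing machine. -/

namespace OracleRAM

/-- Arithmetic expressions. -/
inductive Expr : Type
  | const (n : ℕ) : Expr
  | reg (r : ℕ) : Expr
  | mem (addr : Expr) : Expr
  | add (e₁ e₂ : Expr) : Expr
  | sub (e₁ e₂ : Expr) : Expr

/-- Commands; conditionals and loops test whether an expression is nonzero. -/
inductive Cmd : Type
  | skip : Cmd
  | assign (r : ℕ) (e : Expr) : Cmd
  | store (addr e : Expr) : Cmd
  | flip (r : ℕ) : Cmd
  | query (src dst : Expr) : Cmd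
  | seq (c₁ c₂ : Cmd) : Cmd
  | ite (e : Expr) (c₁ c₂ : Cmd) : Cmd
  | loop (e : Expr) (c : Cmd) : Cmd

/-- Machine states; `coins` is the part of the random tape not yet read, and `queries` is the
number of oracle queries made so far. -/
structure State : Type where
  reg : ℕ → ℕ
  mem : ℕ → ℕ
  coins : ℕ → Bool
  queries : ℕ

/-- The value of an expression. -/
def Expr.val (s : State) : Expr → ℕ
  | .const n => n
  | .reg r => s.reg r
  | .mem a => s.mem (a.val s)
  | .add e₁ e₂ => e₁.val s + e₂.val s
  | .sub e₁ e₂ => e₁.val s - e₂.val s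

/-- The point of `{0,1}^N` stored in the `N` cells from address `a` on (nonzero means `1`). -/
def readBits (N : ℕ) (m : ℕ → ℕ) (a : ℕ) : Fin N → Bool :=
  fun i => decide (m (a + i) ≠ 0)

/-- Write a point of `{0,1}^L` to the `L` cells from address `a` on. -/
def writeBits {L : ℕ} (m : ℕ → ℕ) (a : ℕ) (y : Fin L → Bool) : ℕ → ℕ :=
  fun k => if h : a ≤ k ∧ k - a < L then (y ⟨k - a, h.2⟩).toNat else m k

/-- One step of the machine. A configuration is the list of the commands still to be executed,
together with a state; the machine has halted when the list is empty. -/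
def step {N L : ℕ} (F : (Fin N → Bool) → (Fin L → Bool)) :
    List Cmd × State → List Cmd × State
  | ([], s) => ([], s)
  | (.skip :: K, s) => (K, s)
  | (.assign r e :: K, s) => (K, { s with reg := Function.update s.reg r (e.val s) })
  | (.store a e :: K, s) => (K, { s with mem := Function.update s.mem (a.val s) (e.val s) })
  | (.flip r :: K, s) =>
      (K, { s with
        reg := Function.update s.reg r (s.coins 0).toNat
        coins := fun i => s.coins (i + 1) })
  | (.query src dst :: K, s) =>
      (K, { s with
        mem := writeBits s.mem (dst.val s) (F (readBits N s.mem (src.val s)))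
        queries := s.queries + 1 })
  | (.seq c₁ c₂ :: K, s) => (c₁ :: c₂ :: K, s)
  | (.ite e c₁ c₂ :: K, s) => (if e.val s ≠ 0 then c₁ :: K else c₂ :: K, s)
  | (.loop e c :: K, s) => (if e.val s ≠ 0 then c :: .loop e c :: K else K, s)

/-- The initial state on input `N, L, q, ε, δ` (`ε` and `δ` as numerator and denominator) and
random tape `ω`: the inputs are in registers `0` to `6`, everything else is `0`. -/
def init (N L q : ℕ) (ε δ : ℚ) (ω : ℕ → Bool) : State where
  reg := fun r => [N, L, q, ε.num.toNat, ε.den, δ.num.toNat, δ.den].getD r 0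
  mem := fun _ => 0
  coins := ω
  queries := 0

/-- The configuration that program `A` with oracle `F` reaches after `T` steps. -/
def run {N L : ℕ} (A : Cmd) (F : (Fin N → Bool) → (Fin L → Bool)) (q : ℕ) (ε δ : ℚ)
    (ω : ℕ → Bool) (T : ℕ) : List Cmd × State :=
  (step F)^[T] ([A], init N L q ε δ ω)

/-- The partial assignment written in memory cells `0, …, N - 1`:
`0` means undefined, `1` means the bit `0`, and larger numbers mean the bit `1`. -/
def output (N : ℕ) (s : State) : PartialAssignment N :=
  fun j => if s.mem j = 0 then none else if s.mem j = 1 then some false else some true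

/-- The law of a sequence of independent fair coins. -/
noncomputable def coinMeasure : MeasureTheory.Measure (ℕ → Bool) :=
  MeasureTheory.Measure.infinitePi fun _ => (PMF.uniformOfFintype Bool).toMeasure

end OracleRAM

/-!
A greedy choice of influential coordinates proves both parts. Let `f` be an output bit, restricted
by the current partial assignment, and consider the uniform distribution on the cube.

*Influences.* If `f` is computed by a decision tree of depth `q` and `f(x) ≠ f(y)` has probability
more than `a` for independent `x, y`, then some coordinate has influence more than `2 * a / q`.
This is a weak form of the OSSS inequality (`DTree.Computes.cubeDis_sub_le`), proved by induction
along the tree: resampling the coordinate queried at the root costs half of its influence. The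
total influence of `f` is at most `q`, and assigning a random bit to the coordinate `i` lowers it by
the influence of `i` on average (`totalInfl_eq`). Hence the potential, the sum of the total
influences of all outputs, starts at no more than `L * q`, and as long as some output has a large
variance there is a coordinate whose assignment lowers the potential by `2 * ε / q`. Choosing the
better value each time gives the first part (`exists_smallVariance`).

*The algorithm.* A stage of the randomized search estimates the variances of all outputs, chooses
the output with the largest estimate, estimates the influences of all coordinates on this single
output, chooses the coordinate with the largest estimate and assigns a random bit to it. By
Chebyshev's inequality the numbers of samples need not grow with the logarithm of `N`: the variance
of an empirical influence is bounded by the influence itself, so the union bound over the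
coordinates costs the total influence, which is at most `q` (`Coin.ex_tally_argmax`). No estimate
decides when to stop. Instead the number of stages is uniform in a range of size of
the order of `L * q ^ 2 / (ε * δ)`; the potential pays for the stages at which some variance is
large, so only a fraction `δ` of the stages can be of this kind (`Coin.ex_search`). The estimates of
the variances need `L` times as many samples as those of the influences, which is affordable for
`L < N`. If `N ≤ L`, all coordinates may be assigned, and if `q = 0`, `L = 0`, `ε ≥ 1` or `δ ≥ 1`,
none has to be.

*The program.* Coin-tossing programs are modelled as trees (`Coin`), whose expectations are finite
sums and whose law on the random tape is `Coin.coinMeasure_run`. The relation `OracleRAM.Sim` says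
that a command carries out such a tree within given numbers of steps and queries; it has one rule
for each construct of the language, and the program is verified compositionally with these rules.
-/

/-! ### Coin-tossing programs -/

/-- Finite computations that toss fair coins: a tree that branches at each toss and carries its
results at the leaves. -/
inductive Coin (α : Type) : Type
  | ret (a : α) : Coin α
  | flip (k : Bool → Coin α) : Coin α

namespace Coin

variable {α β γ : Type}

/-- Sequential composition. -/
def bind : Coin α → (α → Coin β) → Coin β
  | ret a, f => f a
  | flip k, f => flip fun b => (k b).bind f

/-- The result on a stream of coins, together with the coins that are left. -/
def run : Coin α → (ℕ → Bool) → α × (ℕ → Bool)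
  | ret a, ω => (a, ω)
  | flip k, ω => (k (ω 0)).run fun i => ω (i + 1)

/-- The expectation of `φ` of the result. -/
noncomputable def ex : Coin α → (α → ℝ) → ℝ
  | ret a, φ => φ a
  | flip k, φ => ((k false).ex φ + (k true).ex φ) / 2

/-- The composition of `f 0, …, f (n - 1)`, in this order, applied to `a`. -/
def iter (f : ℕ → α → Coin α) (a : α) : ℕ → Coin α
  | 0 => ret a
  | n + 1 => (iter f a n).bind (f n)

theorem iter_ret (a : α) (n : ℕ) : iter (fun _ x => ret x) a n = ret a := by
  induction n with
  | zero => rfl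
  | succ n ih => rw [iter, ih]; rfl

theorem run_bind (m : Coin α) (f : α → Coin β) (ω : ℕ → Bool) :
    (m.bind f).run ω = (f (m.run ω).1).run (m.run ω).2 := by
  induction m generalizing ω with
  | ret a => rfl
  | flip k ih => exact ih _ _

theorem bind_ret (m : Coin α) : m.bind ret = m := by
  induction m with
  | ret a => rfl
  | flip k ih => simp [bind, ih]

theorem bind_assoc (m : Coin α) (f : α → Coin β) (g : β → Coin γ) :
    (m.bind f).bind g = m.bind fun a => (f a).bind g := by
  induction m with
  | ret a => rfl
  | flip k ih => simp [bind, ih]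

theorem ex_bind (m : Coin α) (f : α → Coin β) (φ : β → ℝ) :
    (m.bind f).ex φ = m.ex fun a => (f a).ex φ := by
  induction m with
  | ret a => rfl
  | flip k ih => simp only [bind, ex, ih]

theorem ex_iter_succ (f : ℕ → α → Coin α) (a : α) (n : ℕ) (φ : α → ℝ) :
    (iter f a (n + 1)).ex φ = (iter f a n).ex fun x => (f n x).ex φ :=
  ex_bind _ _ _

theorem ex_add (m : Coin α) (φ ψ : α → ℝ) :
    (m.ex fun a => φ a + ψ a) = m.ex φ + m.ex ψ := by
  induction m with
  | ret a => rfl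
  | flip k ih => simp only [ex, ih]; ring

theorem ex_mul_left (m : Coin α) (c : ℝ) (φ : α → ℝ) :
    (m.ex fun a => c * φ a) = c * m.ex φ := by
  induction m with
  | ret a => rfl
  | flip k ih => simp only [ex, ih]; ring

theorem ex_const (m : Coin α) (c : ℝ) : (m.ex fun _ => c) = c := by
  induction m with
  | ret a => rfl
  | flip k ih => simp only [ex, ih]; ring

theorem ex_sub (m : Coin α) (φ ψ : α → ℝ) :
    (m.ex fun a => φ a - ψ a) = m.ex φ - m.ex ψ := by
  induction m with
  | ret a => rfl
  | flip k ih => simp only [ex, ih]; ring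

theorem ex_sum {ι : Type} (s : Finset ι) (m : Coin α) (φ : ι → α → ℝ) :
    (m.ex fun a => ∑ i ∈ s, φ i a) = ∑ i ∈ s, m.ex (φ i) := by
  induction m with
  | ret a => rfl
  | flip k ih => simp only [ex, ih, ← Finset.sum_add_distrib, Finset.sum_div]

theorem ex_mono (m : Coin α) {φ ψ : α → ℝ} (h : ∀ a, φ a ≤ ψ a) : m.ex φ ≤ m.ex ψ := by
  induction m with
  | ret a => exact h a
  | flip k ih => simp only [ex]; linarith [ih false, ih true]

open MeasureTheory Classical in
/-- The first coin is fair and independent of the rest of the tape. -/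
theorem coinMeasure_eq :
    OracleRAM.coinMeasure = (1 / 2 : ENNReal) •
      (OracleRAM.coinMeasure.map (fun ω i => Nat.casesOn i false ω : (ℕ → Bool) → ℕ → Bool) +
        OracleRAM.coinMeasure.map (fun ω i => Nat.casesOn i true ω : (ℕ → Bool) → ℕ → Bool)) := by
  have hmeas : ∀ b : Bool,
      Measurable (fun ω i => Nat.casesOn i b ω : (ℕ → Bool) → ℕ → Bool) := by
    intro b
    refine measurable_pi_lambda _ fun i => ?_
    cases i with
    | zero => exact measurable_const
    | succ i => exact measurable_pi_apply i
  set ν := (PMF.uniformOfFintype Bool).toMeasure with hν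
  symm
  refine Measure.eq_infinitePi (μ := fun _ => ν) fun s t ht => ?_
  obtain ⟨n, hn⟩ : ∃ n, s ⊆ Finset.range (n + 1) :=
    ⟨s.sup id, fun i hi => Finset.mem_range.2 (Nat.lt_succ_of_le (Finset.le_sup (f := id) hi))⟩
  -- A box over `s` is a box over an initial segment of the tape.
  set t' : ℕ → Set Bool := fun i => if i ∈ s then t i else Set.univ with ht'
  have hset : Set.pi (s : Set ℕ) t = Set.pi (Finset.range (n + 1) : Set ℕ) t' := by
    ext ω
    simp only [Set.mem_pi, ht', Finset.mem_coe]
    constructor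
    · intro h i _
      by_cases hi : i ∈ s <;> simp [hi, h]
    · intro h i hi
      simpa [hi] using h i (hn hi)
  have hprod : ∏ i ∈ s, ν (t i) = ∏ i ∈ Finset.range (n + 1), ν (t' i) := by
    rw [← Finset.prod_subset hn]
    · exact Finset.prod_congr rfl fun i hi => by simp [ht', hi]
    · intro i _ hi
      simp only [ht', if_neg hi]
      exact measure_univ
  have hm' : ∀ i, MeasurableSet (t' i) := fun i => MeasurableSet.of_discrete
  have hbox : MeasurableSet (Set.pi (Finset.range (n + 1) : Set ℕ) t') :=
    MeasurableSet.pi (Finset.countable_toSet _) fun i _ => hm' i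
  have hpre : ∀ b : Bool, OracleRAM.coinMeasure ((fun ω i => Nat.casesOn i b ω :
      (ℕ → Bool) → ℕ → Bool) ⁻¹' Set.pi (Finset.range (n + 1) : Set ℕ) t') =
      (if b ∈ t' 0 then 1 else 0) * ∏ i ∈ Finset.range n, ν (t' (i + 1)) := by
    intro b
    have : (fun ω i => Nat.casesOn i b ω : (ℕ → Bool) → ℕ → Bool) ⁻¹'
        Set.pi (Finset.range (n + 1) : Set ℕ) t' =
        if b ∈ t' 0 then Set.pi (Finset.range n : Set ℕ) (fun i => t' (i + 1)) else ∅ := by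
      ext ω
      split_ifs with hb
      · simp only [Set.mem_preimage, Set.mem_pi, Finset.mem_coe, Finset.mem_range]
        constructor
        · intro h i hi
          exact h (i + 1) (by omega)
        · intro h i hi
          cases i with
          | zero => exact hb
          | succ i => exact h i (by omega)
      · simp only [Set.mem_preimage, Set.mem_pi, Finset.mem_coe, Finset.mem_range,
          Set.mem_empty_iff_false, iff_false]
        exact fun h => hb (h 0 (by omega))
    rw [this]
    split_ifs
    · rw [OracleRAM.coinMeasure, Measure.infinitePi_pi _ fun i _ => hm' (i + 1), one_mul]
    · simp
  rw [hset, hprod, Measure.smul_apply, Measure.add_apply, Measure.map_apply (hmeas _) hbox,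
    Measure.map_apply (hmeas _) hbox, hpre, hpre, Finset.prod_range_succ', ← add_mul, smul_eq_mul,
    ← mul_assoc, mul_comm]
  congr 1
  rw [hν, PMF.toMeasure_apply_fintype]
  simp only [Fintype.sum_bool, Set.indicator_apply, PMF.uniformOfFintype_apply, Fintype.card_bool]
  split_ifs <;> simp [mul_add]

open Classical in
theorem measurableSet_run (m : Coin α) (p : α → Prop) :
    MeasurableSet {ω | p (m.run ω).1} := by
  induction m with
  | ret a => exact MeasurableSet.const (p a)
  | flip k ih =>
    have h : ∀ b : Bool, MeasurableSet
        ({ω : ℕ → Bool | ω 0 = b} ∩ (fun ω i => ω (i + 1)) ⁻¹' {ω | p ((k b).run ω).1}) := by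
      intro b
      have h0 : Measurable fun ω : ℕ → Bool => ω 0 := measurable_pi_apply 0
      refine MeasurableSet.inter (h0 (measurableSet_singleton b)) ?_
      exact (measurable_pi_lambda _ fun i => measurable_pi_apply (i + 1)) (ih b)
    convert (h false).union (h true) using 1
    ext ω
    cases hω : ω 0 <;> simp [run, hω]

open MeasureTheory Classical in
/-- On a random tape a coin-tossing program has property `p` with probability the expectation of
the indicator of `p`. -/
theorem coinMeasure_run (m : Coin α) (p : α → Prop) :
    OracleRAM.coinMeasure {ω | p (m.run ω).1} =
      ENNReal.ofReal (m.ex fun a => if p a then 1 else 0) := by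
  have : IsProbabilityMeasure OracleRAM.coinMeasure := by
    unfold OracleRAM.coinMeasure; infer_instance
  induction m with
  | ret a => by_cases h : p a <;> simp [run, ex, h]
  | flip k ih =>
    have hmeas : ∀ b : Bool,
        Measurable (fun ω i => Nat.casesOn i b ω : (ℕ → Bool) → ℕ → Bool) := by
      intro b
      refine measurable_pi_lambda _ fun i => ?_
      cases i with
      | zero => exact measurable_const
      | succ i => exact measurable_pi_apply i
    have h0 : ∀ b, 0 ≤ (k b).ex fun a => if p a then (1 : ℝ) else 0 := fun b =>
      (ex_const (k b) 0).symm.le.trans (ex_mono _ fun a => by split_ifs <;> norm_num)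
    have hs := measurableSet_run (flip k) p
    rw [coinMeasure_eq, Measure.smul_apply, Measure.add_apply, Measure.map_apply (hmeas _) hs,
      Measure.map_apply (hmeas _) hs]
    have e : ∀ b, (fun ω i => Nat.casesOn i b ω : (ℕ → Bool) → ℕ → Bool) ⁻¹'
        {ω | p ((flip k).run ω).1} = {ω | p ((k b).run ω).1} := fun b => rfl
    rw [e, e, ih, ih, ← ENNReal.ofReal_add (h0 _) (h0 _), smul_eq_mul, ex,
      ENNReal.ofReal_div_of_pos (by norm_num)]
    simp [div_eq_mul_inv, mul_comm]

end Coin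

/-! ### Averages over the cube and influences -/

section Cube

variable {N : ℕ}

/-- The average of `φ` over `{0,1}^N`. -/
noncomputable def cubeAvg (φ : (Fin N → Bool) → ℝ) : ℝ := (∑ x, φ x) / 2 ^ N

/-- `x` with its `i`-th coordinate negated. -/
def flipAt (i : Fin N) (x : Fin N → Bool) : Fin N → Bool := Function.update x i (!x i)

/-- `x` with its `i`-th coordinate replaced by `b`. -/
def setAt (i : Fin N) (b : Bool) (x : Fin N → Bool) : Fin N → Bool := Function.update x i b

/-- The real-valued indicator of `a ≠ b`. -/
def neInd (a b : Bool) : ℝ := if a ≠ b then 1 else 0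

theorem neInd_nonneg (a b : Bool) : 0 ≤ neInd a b := by unfold neInd; split_ifs <;> norm_num

theorem neInd_le_one (a b : Bool) : neInd a b ≤ 1 := by unfold neInd; split_ifs <;> norm_num

theorem neInd_self (a : Bool) : neInd a a = 0 := by simp [neInd]

theorem neInd_triangle (a b c : Bool) : neInd a c ≤ neInd a b + neInd b c := by
  cases a <;> cases b <;> cases c <;> norm_num [neInd]

theorem cubeAvg_add (φ ψ : (Fin N → Bool) → ℝ) :
    (cubeAvg fun x => φ x + ψ x) = cubeAvg φ + cubeAvg ψ := by
  simp only [cubeAvg, Finset.sum_add_distrib, add_div]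

theorem cubeAvg_sub (φ ψ : (Fin N → Bool) → ℝ) :
    (cubeAvg fun x => φ x - ψ x) = cubeAvg φ - cubeAvg ψ := by
  simp only [cubeAvg, Finset.sum_sub_distrib, sub_div]

theorem cubeAvg_mul_left (c : ℝ) (φ : (Fin N → Bool) → ℝ) :
    (cubeAvg fun x => c * φ x) = c * cubeAvg φ := by
  simp only [cubeAvg, ← Finset.mul_sum, mul_div_assoc]

theorem cubeAvg_const (c : ℝ) : (cubeAvg fun _ : Fin N → Bool => c) = c := by
  simp [cubeAvg]

theorem cubeAvg_mono {φ ψ : (Fin N → Bool) → ℝ} (h : ∀ x, φ x ≤ ψ x) :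
    cubeAvg φ ≤ cubeAvg ψ :=
  div_le_div_of_nonneg_right (Finset.sum_le_sum fun x _ => h x) (by positivity)

theorem cubeAvg_nonneg {φ : (Fin N → Bool) → ℝ} (h : ∀ x, 0 ≤ φ x) : 0 ≤ cubeAvg φ :=
  div_nonneg (Finset.sum_nonneg fun x _ => h x) (by positivity)

theorem flipAt_flipAt (i : Fin N) (x : Fin N → Bool) : flipAt i (flipAt i x) = x := by
  simp [flipAt]

theorem cubeAvg_flipAt (i : Fin N) (φ : (Fin N → Bool) → ℝ) :
    (cubeAvg fun x => φ (flipAt i x)) = cubeAvg φ := by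
  unfold cubeAvg
  congr 1
  exact Equiv.sum_comp (Function.Involutive.toPerm (flipAt i) (flipAt_flipAt i)) φ

/-- Averaging over the coordinate `i` separately. -/
theorem cubeAvg_setAt (i : Fin N) (φ : (Fin N → Bool) → ℝ) :
    cubeAvg φ =
      ((cubeAvg fun x => φ (setAt i false x)) + cubeAvg fun x => φ (setAt i true x)) / 2 := by
  have h : (cubeAvg fun x => φ (setAt i false x) + φ (setAt i true x)) =
      cubeAvg fun x => φ x + φ (flipAt i x) := by
    congr 1
    funext x
    have hx : setAt i (x i) x = x := by simp [setAt]
    cases hb : x i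
    · rw [hb] at hx
      rw [hx, flipAt, hb, setAt, Bool.not_false]
    · rw [hb] at hx
      rw [hx, flipAt, hb, setAt, Bool.not_true, add_comm]
  rw [← cubeAvg_add, h, cubeAvg_add, cubeAvg_flipAt]
  ring

/-- The influence of the coordinate `i` on `f`: the probability that negating it in a uniform
point changes the value of `f`. -/
noncomputable def infl (i : Fin N) (f : (Fin N → Bool) → Bool) : ℝ :=
  cubeAvg fun x => neInd (f x) (f (flipAt i x))

/-- The total influence of `f`. -/
noncomputable def totalInfl (f : (Fin N → Bool) → Bool) : ℝ := ∑ i, infl i f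

/-- The probability that `f` and `h` differ at two independent uniform points. -/
noncomputable def cubeDis (f h : (Fin N → Bool) → Bool) : ℝ :=
  cubeAvg fun x => cubeAvg fun y => neInd (f x) (h y)

theorem infl_nonneg (i : Fin N) (f : (Fin N → Bool) → Bool) : 0 ≤ infl i f :=
  cubeAvg_nonneg fun _ => neInd_nonneg _ _

theorem infl_le_one (i : Fin N) (f : (Fin N → Bool) → Bool) : infl i f ≤ 1 :=
  (cubeAvg_mono fun _ => neInd_le_one _ _).trans (cubeAvg_const 1).le

theorem totalInfl_nonneg (f : (Fin N → Bool) → Bool) : 0 ≤ totalInfl f :=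
  Finset.sum_nonneg fun i _ => infl_nonneg i f

theorem cubeDis_nonneg (f h : (Fin N → Bool) → Bool) : 0 ≤ cubeDis f h :=
  cubeAvg_nonneg fun _ => cubeAvg_nonneg fun _ => neInd_nonneg _ _

theorem cubeDis_le_one (f h : (Fin N → Bool) → Bool) : cubeDis f h ≤ 1 :=
  (cubeAvg_mono fun _ => (cubeAvg_mono fun _ => neInd_le_one _ _).trans (cubeAvg_const 1).le).trans
    (cubeAvg_const 1).le

theorem setAt_flipAt_self (i : Fin N) (b : Bool) (x : Fin N → Bool) :
    setAt i b (flipAt i x) = setAt i b x := by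
  simp [setAt, flipAt]

theorem flipAt_setAt_of_ne {i j : Fin N} (h : j ≠ i) (b : Bool) (x : Fin N → Bool) :
    flipAt j (setAt i b x) = setAt i b (flipAt j x) := by
  simp only [flipAt, setAt, Function.update_of_ne h]
  exact Function.update_comm h.symm _ _ _

/-- Restricting a random value of the coordinate `i` removes the influence of `i` from the total
influence, and changes nothing else on average. -/
theorem totalInfl_eq (i : Fin N) (f : (Fin N → Bool) → Bool) :
    totalInfl f = infl i f +
      (totalInfl (fun x => f (setAt i false x)) + totalInfl (fun x => f (setAt i true x))) / 2 := by
  have hself : ∀ b, infl i (fun x => f (setAt i b x)) = 0 := by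
    intro b
    simp only [infl, setAt_flipAt_self, neInd_self, cubeAvg_const]
  have hne : ∀ j, j ≠ i → infl j f =
      (infl j (fun x => f (setAt i false x)) + infl j (fun x => f (setAt i true x))) / 2 := by
    intro j hj
    rw [infl, cubeAvg_setAt i]
    simp only [infl, flipAt_setAt_of_ne hj]
  unfold totalInfl
  rw [← Finset.add_sum_erase _ _ (Finset.mem_univ i),
    ← Finset.add_sum_erase _ (fun j => infl j fun x => f (setAt i false x)) (Finset.mem_univ i),
    ← Finset.add_sum_erase _ (fun j => infl j fun x => f (setAt i true x)) (Finset.mem_univ i),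
    hself, hself, zero_add, zero_add, ← Finset.sum_add_distrib, Finset.sum_div]
  congr 1
  exact Finset.sum_congr rfl fun j hj => hne j (Finset.ne_of_mem_erase hj)

end Cube

/-! ### Decision trees and influences -/

namespace DTree

variable {N : ℕ}

/-- The tree with the queries to the coordinate `i` answered by `b`. -/
def restrict (i : Fin N) (b : Bool) : DTree N → DTree N
  | leaf c => leaf c
  | node j t₀ t₁ =>
      if j = i then (if b then t₁.restrict i b else t₀.restrict i b)
      else node j (t₀.restrict i b) (t₁.restrict i b)

theorem depth_restrict_le (i : Fin N) (b : Bool) (T : DTree N) :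
    (T.restrict i b).depth ≤ T.depth := by
  induction T with
  | leaf c => exact le_rfl
  | node j t₀ t₁ h₀ h₁ =>
    unfold restrict
    split_ifs <;> simp only [depth] <;> omega

theorem eval_restrict (i : Fin N) (b : Bool) (T : DTree N) (x : Fin N → Bool) :
    (T.restrict i b).eval x = T.eval (setAt i b x) := by
  induction T with
  | leaf c => rfl
  | node j t₀ t₁ h₀ h₁ =>
    unfold restrict
    by_cases hj : j = i
    · subst hj
      cases b <;> simp [eval, setAt, h₀, h₁]
    · simp only [hj, if_false, eval, h₀, h₁, setAt, Function.update_of_ne hj]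

theorem Computes.comp_setAt {q : ℕ} {f : (Fin N → Bool) → Bool} (h : Computes q f) (i : Fin N)
    (b : Bool) : Computes q fun x => f (setAt i b x) := by
  obtain ⟨T, hd, hT⟩ := h
  exact ⟨T.restrict i b, (depth_restrict_le i b T).trans hd, fun x => by
    rw [eval_restrict, hT]⟩

theorem Computes.const_or {q : ℕ} {f : (Fin N → Bool) → Bool} (h : Computes (q + 1) f) :
    (∃ c, ∀ x, f x = c) ∨ ∃ i, ∀ b, Computes q fun x => f (setAt i b x) := by
  obtain ⟨T, hd, hT⟩ := h
  cases T with
  | leaf c => exact Or.inl ⟨c, fun x => (hT x).symm⟩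
  | node i t₀ t₁ =>
    right
    simp only [depth] at hd
    refine ⟨i, fun b => ?_⟩
    cases b
    · refine ⟨t₀.restrict i false, (depth_restrict_le _ _ _).trans (by omega), fun x => ?_⟩
      rw [eval_restrict]
      simp [← hT, eval, setAt]
    · refine ⟨t₁.restrict i true, (depth_restrict_le _ _ _).trans (by omega), fun x => ?_⟩
      rw [eval_restrict]
      simp [← hT, eval, setAt]

theorem Computes.const {f : (Fin N → Bool) → Bool} (h : Computes 0 f) : ∃ c, ∀ x, f x = c := by
  obtain ⟨T, hd, hT⟩ := h
  cases T with
  | leaf c => exact ⟨c, fun x => (hT x).symm⟩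
  | node i t₀ t₁ => simp [depth] at hd

theorem totalInfl_eq_zero_of_const {f : (Fin N → Bool) → Bool} (h : ∃ c, ∀ x, f x = c) :
    totalInfl f = 0 := by
  obtain ⟨c, hc⟩ := h
  simp [totalInfl, infl, hc, neInd_self, cubeAvg_const]

/-- The total influence of a decision tree is at most its depth. -/
theorem Computes.totalInfl_le {q : ℕ} {f : (Fin N → Bool) → Bool} (h : Computes q f) :
    totalInfl f ≤ q := by
  induction q generalizing f with
  | zero => simp [totalInfl_eq_zero_of_const h.const]
  | succ q ih =>
    rcases h.const_or with hc | ⟨i, hi⟩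
    · rw [totalInfl_eq_zero_of_const hc]; positivity
    · rw [totalInfl_eq i]
      push_cast
      linarith [infl_le_one i f, ih (hi false), ih (hi true)]

/-- A one-sided form of the OSSS inequality. If `f` has depth at most `q` and no coordinate has
influence more than `M` on `h`, then making the arguments of `f` and `h` independent raises the
probability of `f ≠ h` by at most `q * M / 2`: each query of the tree costs half the influence of
the queried coordinate. -/
theorem Computes.cubeDis_sub_le {q : ℕ} {f h : (Fin N → Bool) → Bool} (hf : Computes q f) {M : ℝ}
    (hM0 : 0 ≤ M) (hM : ∀ i, infl i h ≤ M) :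
    cubeDis f h - cubeAvg (fun x => neInd (f x) (h x)) ≤ q * M / 2 := by
  have hconst : (∃ c, ∀ x, f x = c) →
      cubeDis f h - cubeAvg (fun x => neInd (f x) (h x)) = 0 := by
    rintro ⟨c, hc⟩
    simp only [cubeDis, hc, cubeAvg_const, sub_self]
  induction q generalizing f with
  | zero => rw [hconst hf.const]; simp
  | succ q ih =>
    rcases hf.const_or with hc | ⟨i, hi⟩
    · rw [hconst hc]; positivity
    have key : ∀ b, cubeDis (fun x => f (setAt i b x)) h -
        cubeAvg (fun x => neInd (f (setAt i b x)) (h x)) ≤ q * M / 2 := by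
      refine fun b => ih (hi b) ?_
      rintro ⟨c, hc⟩
      simp only [cubeDis, hc, cubeAvg_const, sub_self]
    have hdis : cubeDis f h = (cubeDis (fun x => f (setAt i false x)) h +
        cubeDis (fun x => f (setAt i true x)) h) / 2 := by
      rw [cubeDis, cubeAvg_setAt i]; rfl
    have hagree : cubeAvg (fun x => neInd (f x) (h x)) =
        (cubeAvg (fun x => neInd (f (setAt i false x)) (h (setAt i false x))) +
        cubeAvg (fun x => neInd (f (setAt i true x)) (h (setAt i true x)))) / 2 :=
      cubeAvg_setAt i _
    have htri : ∀ b, cubeAvg (fun x => neInd (f (setAt i b x)) (h x)) ≤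
        cubeAvg (fun x => neInd (f (setAt i b x)) (h (setAt i b x))) +
        cubeAvg (fun x => neInd (h (setAt i b x)) (h x)) := by
      intro b
      rw [← cubeAvg_add]
      exact cubeAvg_mono fun x => neInd_triangle _ _ _
    -- Exactly one of the two values of the coordinate `i` differs from its value in `x`.
    have hinf : cubeAvg (fun x => neInd (h (setAt i false x)) (h x)) +
        cubeAvg (fun x => neInd (h (setAt i true x)) (h x)) = infl i h := by
      rw [← cubeAvg_add, infl]
      congr 1
      funext x
      have hx : setAt i (x i) x = x := by simp [setAt]
      have hfl : flipAt i x = setAt i (!x i) x := rfl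
      rw [hfl]
      cases hb : x i <;> rw [hb] at hx <;> simp [hx, neInd, eq_comm]
    push_cast
    linarith [key false, key true, htri false, htri true, hM i]

/-- A function of depth at most `q` whose values at two independent points differ with
probability more than `a` has a coordinate of influence more than `2 * a / q`. -/
theorem Computes.exists_infl {q : ℕ} {f : (Fin N → Bool) → Bool} (hf : Computes q f) {a : ℝ}
    (ha : 0 ≤ a) (h : a < cubeDis f f) : ∃ i, 2 * a < q * infl i f := by
  by_contra! hcon
  have hq : 0 < q := by
    rcases Nat.eq_zero_or_pos q with rfl | hq
    · obtain ⟨c, hc⟩ := hf.const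
      simp only [cubeDis, hc, neInd_self, cubeAvg_const] at h
      linarith
    · exact hq
  have hq' : (0 : ℝ) < q := Nat.cast_pos.2 hq
  have := hf.cubeDis_sub_le (h := f) (M := 2 * a / q) (by positivity) fun i => by
    rw [le_div_iff₀ hq', mul_comm]; exact hcon i
  simp only [neInd_self, cubeAvg_const] at this
  rw [mul_div_cancel₀ _ hq'.ne'] at this
  linarith

end DTree

/-! ### Partial assignments -/

namespace PartialAssignment

variable {N : ℕ}

/-- `x` overwritten by `g`. -/
def patch (g : PartialAssignment N) (x : Fin N → Bool) : Fin N → Bool := fun j => (g j).getD (x j)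

/-- Assign `b` to the coordinate `i`, if `i` is not assigned yet. -/
def fix (g : PartialAssignment N) (i : Fin N) (b : Bool) : PartialAssignment N :=
  if g i = none then Function.update g i (some b) else g

theorem patch_fix {g : PartialAssignment N} {i : Fin N} (hi : g i = none) (b : Bool)
    (x : Fin N → Bool) : (g.fix i b).patch x = g.patch (setAt i b x) := by
  funext j
  rw [fix, if_pos hi]
  by_cases hj : j = i
  · subst hj; simp [patch, setAt, hi]
  · simp [patch, setAt, Function.update_of_ne hj]

theorem patch_flipAt_of_ne {g : PartialAssignment N} {i : Fin N} (hi : g i ≠ none)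
    (x : Fin N → Bool) : g.patch (flipAt i x) = g.patch x := by
  funext j
  by_cases hj : j = i
  · subst hj
    obtain ⟨b, hb⟩ := Option.ne_none_iff_exists'.1 hi
    simp [patch, hb]
  · simp [patch, flipAt, Function.update_of_ne hj]

theorem card_dom_fix_le (g : PartialAssignment N) (i : Fin N) (b : Bool) :
    (g.fix i b).dom.card ≤ g.dom.card + 1 := by
  refine (Finset.card_le_card (t := insert i g.dom) fun j hj => ?_).trans
    (Finset.card_insert_le _ _)
  by_cases hij : j = i
  · simp [hij]
  · unfold fix at hj
    split_ifs at hj <;> simp_all [dom]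

theorem _root_.DTree.Computes.comp_patch {q : ℕ} {f : (Fin N → Bool) → Bool}
    (h : DTree.Computes q f) (g : PartialAssignment N) :
    DTree.Computes q fun x => f (g.patch x) := by
  -- Assign the coordinates in the domain of `g` one after the other.
  suffices H : ∀ s : Finset (Fin N),
      DTree.Computes q fun x => f fun j => if j ∈ s then (g j).getD (x j) else x j by
    have h := H Finset.univ
    simp only [Finset.mem_univ, if_true] at h
    exact h
  intro s
  induction s using Finset.induction_on with
  | empty => simpa using h
  | insert i s hi ih =>
    cases hg : g i with
    | none =>
      convert ih using 4 with x j
      by_cases hj : j = i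
      · simp [hj, hg]
      · simp [hj]
    | some b =>
      convert ih.comp_setAt i b using 4 with x j
      by_cases hj : j = i
      · subst hj; simp [hg, hi, setAt]
      · simp [hj, setAt]

/-- The expectation under `U_g` is the average over uniform points overwritten by `g`. -/
theorem expect_unif (g : PartialAssignment N) (φ : (Fin N → Bool) → ℝ) :
    expect g.unif φ = cubeAvg fun x => φ (g.patch x) := by
  classical
  set w : Fin N → Bool → ℝ := fun j b => if g j = none then 1 / 2 else if g j = some b then 1 else 0
    with hw
  have hunif : ∀ z, g.unif z = ∏ j, w j (z j) := by
    intro z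
    unfold unif
    split_ifs with hz
    · have h1 : ∀ j, w j (z j) = if g j = none then 1 / 2 else 1 := by
        intro j
        rcases hg : g j with _ | b
        · simp [hw, hg]
        · simp [hw, hg, hz j b hg]
      have h2 : (Finset.univ.filter fun j => g j = none).card = N - g.dom.card := by
        have : (Finset.univ.filter fun j => g j = none) = g.domᶜ := by
          ext j; simp [dom]
        rw [this, Finset.card_compl, Fintype.card_fin]
      rw [Finset.prod_congr rfl fun j _ => h1 j, Finset.prod_ite, Finset.prod_const,
        Finset.prod_const_one, h2, mul_one, one_div_pow]
    · simp only [Agrees, not_forall] at hz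
      obtain ⟨j, b, hj, hne⟩ := hz
      refine (Finset.prod_eq_zero (Finset.mem_univ j) ?_).symm
      simp [hw, hj, Ne.symm hne]
  have hcount : ∀ z, (∑ x, if g.patch x = z then (1 : ℝ) else 0) = 2 ^ N * g.unif z := by
    intro z
    have h1 : ∀ x, (if g.patch x = z then (1 : ℝ) else 0) =
        ∏ j, if (g j).getD (x j) = z j then 1 else 0 := by
      intro x
      rw [Finset.prod_ite_zero]
      simp [funext_iff, patch]
    have h2 : ∀ j, (∑ b : Bool, if (g j).getD b = z j then (1 : ℝ) else 0) = 2 * w j (z j) := by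
      intro j
      rcases hg : g j with _ | b
      · cases z j <;> simp [hw, hg]
      · by_cases hb : b = z j <;> simp [hw, hg, hb]
    rw [Finset.sum_congr rfl fun x _ => h1 x, hunif]
    have h3 := Finset.prod_univ_sum (fun _ : Fin N => (Finset.univ : Finset Bool))
      fun j b => if (g j).getD b = z j then (1 : ℝ) else 0
    rw [Fintype.piFinset_univ] at h3
    rw [← h3, Finset.prod_congr rfl fun j _ => h2 j, Finset.prod_mul_distrib, Finset.prod_const,
      Finset.card_univ, Fintype.card_fin]
  have hsum : ∑ x, φ (g.patch x) = ∑ z, φ z * (2 ^ N * g.unif z) := by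
    simp only [← hcount, Finset.mul_sum, mul_ite, mul_one, mul_zero]
    rw [Finset.sum_comm]
    simp
  rw [expect, cubeAvg, hsum, Finset.sum_div]
  refine Finset.sum_congr rfl fun z _ => ?_
  field_simp

theorem disagreement_unif (g : PartialAssignment N) (f : (Fin N → Bool) → Bool) :
    disagreement g.unif f = cubeDis (fun x => f (g.patch x)) fun x => f (g.patch x) := by
  have h : disagreement g.unif f =
      expect g.unif fun x => expect g.unif fun y => neInd (f x) (f y) := by
    simp only [disagreement, expect, Finset.mul_sum, neInd]
    refine Finset.sum_congr rfl fun x _ => Finset.sum_congr rfl fun y _ => ?_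
    split_ifs <;> simp
  simp only [h, expect_unif]
  rfl

/-- `Pr[f(x) ≠ f(y)]` is twice `E[f^2] - E[f]^2`. -/
theorem disagreement_eq_two_mul (g : PartialAssignment N) (f : (Fin N → Bool) → Bool) :
    disagreement g.unif f = 2 * variance01 g.unif f := by
  set u : (Fin N → Bool) → ℝ := fun x => if f (g.patch x) then 1 else 0 with hu
  have h1 : ∀ x y, neInd (f (g.patch x)) (f (g.patch y)) = u x + u y - 2 * u x * u y := by
    intro x y
    simp only [hu]
    cases f (g.patch x) <;> cases f (g.patch y) <;> norm_num [neInd]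
  have h2 : ∀ x, u x ^ 2 = u x := by
    intro x
    simp only [hu]
    split_ifs <;> norm_num
  rw [disagreement_unif, variance01, expect_unif, expect_unif]
  change (cubeAvg fun x => cubeAvg fun y => neInd (f (g.patch x)) (f (g.patch y))) =
    2 * ((cubeAvg fun x => u x ^ 2) - (cubeAvg u) ^ 2)
  have h3 : ∀ x, (cubeAvg fun y => u x + u y - 2 * u x * u y) =
      u x + cubeAvg u - 2 * cubeAvg u * u x := by
    intro x
    rw [cubeAvg_sub, cubeAvg_add, cubeAvg_const, cubeAvg_mul_left]
    ring
  simp only [h1, h2, h3]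
  rw [cubeAvg_sub, cubeAvg_add, cubeAvg_const, cubeAvg_mul_left]
  change cubeAvg u + cubeAvg u - 2 * cubeAvg u * cubeAvg u = 2 * (cubeAvg u - cubeAvg u ^ 2)
  ring

end PartialAssignment

section Potential

open PartialAssignment

variable {N L : ℕ} {F : (Fin N → Bool) → (Fin L → Bool)}

theorem smallVariance_iff (ε : ℝ) (g : PartialAssignment N) :
    SmallVariance F ε g ↔
      ∀ t, cubeDis (fun x => F (g.patch x) t) (fun x => F (g.patch x) t) ≤ ε := by
  refine forall_congr' fun t => ?_
  have h := disagreement_eq_two_mul g fun x => F x t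
  have h' := disagreement_unif g fun x => F x t
  have h0 := cubeDis_nonneg (fun x => F (g.patch x) t) fun x => F (g.patch x) t
  constructor
  · exact fun hs => h'.symm.le.trans hs.2
  · exact fun hs => ⟨by linarith, h'.le.trans hs⟩

/-- The sum over the outputs of the influence of the coordinate `i` under `U_g`. -/
noncomputable def sumInfl (F : (Fin N → Bool) → (Fin L → Bool)) (g : PartialAssignment N)
    (i : Fin N) : ℝ :=
  ∑ t, infl i fun x => F (g.patch x) t

/-- The sum over the outputs of the total influence under `U_g`. -/
noncomputable def potential (F : (Fin N → Bool) → (Fin L → Bool)) (g : PartialAssignment N) : ℝ :=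
  ∑ t, totalInfl fun x => F (g.patch x) t

theorem sumInfl_nonneg (g : PartialAssignment N) (i : Fin N) : 0 ≤ sumInfl F g i :=
  Finset.sum_nonneg fun _ _ => infl_nonneg _ _

theorem potential_nonneg (g : PartialAssignment N) : 0 ≤ potential F g :=
  Finset.sum_nonneg fun _ _ => totalInfl_nonneg _

theorem infl_le_sumInfl (g : PartialAssignment N) (i : Fin N) (t : Fin L) :
    infl i (fun x => F (g.patch x) t) ≤ sumInfl F g i :=
  Finset.single_le_sum (f := fun t => infl i fun x => F (g.patch x) t)
    (fun _ _ => infl_nonneg _ _) (Finset.mem_univ t)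

theorem infl_patch_eq_zero {g : PartialAssignment N} {i : Fin N} (hi : g i ≠ none) (t : Fin L) :
    infl i (fun x => F (g.patch x) t) = 0 := by
  simp only [infl, patch_flipAt_of_ne hi, neInd_self, cubeAvg_const]

/-- Assigning a random bit to the coordinate `i` lowers the potential by `sumInfl F g i`, on
average. -/
theorem potential_fix (g : PartialAssignment N) (i : Fin N) :
    (potential F (g.fix i false) + potential F (g.fix i true)) / 2 =
      potential F g - sumInfl F g i := by
  by_cases hi : g i = none
  · have h : potential F g = ∑ t, (infl i (fun x => F (g.patch x) t) +
        (totalInfl (fun x => F ((g.fix i false).patch x) t) +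
          totalInfl (fun x => F ((g.fix i true).patch x) t)) / 2) := by
      refine Finset.sum_congr rfl fun t _ => ?_
      simp only [patch_fix hi]
      exact totalInfl_eq i _
    rw [h]
    simp only [potential, sumInfl, Finset.sum_add_distrib, ← Finset.sum_div]
    ring
  · simp only [sumInfl, infl_patch_eq_zero hi, fix, if_neg hi, Finset.sum_const_zero]
    ring

theorem potential_le {q : ℕ} (hF : ∀ t, DTree.Computes q fun x => F x t)
    (g : PartialAssignment N) : potential F g ≤ L * q := by
  refine (Finset.sum_le_sum fun t _ => ((hF t).comp_patch g).totalInfl_le).trans ?_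
  simp

/-- The greedy choice of influential coordinates, with the better of the two values. -/
theorem exists_smallVariance {q : ℕ} (hF : ∀ t, DTree.Computes q fun x => F x t) {ε : ℝ}
    (hε : 0 < ε) (g : PartialAssignment N) :
    ∃ g' : PartialAssignment N, SmallVariance F ε g' ∧
      g'.dom.card * ε + q * potential F g' ≤ g.dom.card * ε + q * potential F g := by
  induction hn : N - g.dom.card using Nat.strong_induction_on generalizing g with
  | _ n ih =>
    by_cases hg : SmallVariance F ε g
    · exact ⟨g, hg, le_rfl⟩
    simp only [smallVariance_iff, not_forall, not_le] at hg
    obtain ⟨t, ht⟩ := hg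
    obtain ⟨i, hi⟩ := ((hF t).comp_patch g).exists_infl hε.le ht
    have hnone : g i = none := by
      by_contra hne
      rw [infl_patch_eq_zero hne] at hi
      linarith
    have hW : 2 * ε < q * sumInfl F g i :=
      hi.trans_le (mul_le_mul_of_nonneg_left (infl_le_sumInfl g i t) (Nat.cast_nonneg q))
    obtain ⟨b, hb⟩ : ∃ b, potential F (g.fix i b) ≤ potential F g - sumInfl F g i := by
      by_contra! hcon
      linarith [potential_fix (F := F) g i, hcon false, hcon true]
    have hcard : (g.fix i b).dom.card = g.dom.card + 1 := by
      have : (g.fix i b).dom = insert i g.dom := by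
        ext j
        by_cases hj : j = i
        · subst hj; simp [fix, hnone, dom]
        · simp [fix, hnone, dom, hj]
      rw [this, Finset.card_insert_of_notMem]
      simp [dom, hnone]
    have hle : (g.fix i b).dom.card ≤ N := by
      simpa using Finset.card_le_univ (g.fix i b).dom
    obtain ⟨g', hg', hle'⟩ := ih _ (by omega) (g.fix i b) rfl
    refine ⟨g', hg', hle'.trans ?_⟩
    rw [hcard]
    push_cast
    nlinarith [mul_le_mul_of_nonneg_left hb (Nat.cast_nonneg (α := ℝ) q)]

end Potential

/-! ### Running programs step by step -/

namespace OracleRAM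

variable {N L : ℕ} {F : (Fin N → Bool) → (Fin L → Bool)} {α β : Type}

/-- From state `s` the command `c` takes exactly `n` steps and ends in state `s'`, whatever is to
be executed afterwards. -/
def Steps (F : (Fin N → Bool) → (Fin L → Bool)) (c : Cmd) (s : State) (n : ℕ) (s' : State) :
    Prop :=
  ∀ K, (step F)^[n] (c :: K, s) = (K, s')

/-- From state `s` the command `c` carries out the coin-tossing program `m`, in at most `t` steps
and with at most `q` queries: it reads the coins that `m` reads, and its final state is related by
`Q` to the result of `m`. -/
def Sim (F : (Fin N → Bool) → (Fin L → Bool)) (c : Cmd) (s : State) (m : Coin α) (t q : ℕ)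
    (Q : α → State → Prop) : Prop :=
  ∃ n ≤ t, ∃ s', Steps F c s n s' ∧ s'.coins = (m.run s.coins).2 ∧
    s'.queries ≤ s.queries + q ∧ Q (m.run s.coins).1 s'

theorem Steps.seq {c₁ c₂ : Cmd} {s s₁ s₂ : State} {n₁ n₂ : ℕ} (h₁ : Steps F c₁ s n₁ s₁)
    (h₂ : Steps F c₂ s₁ n₂ s₂) : Steps F (.seq c₁ c₂) s (n₁ + n₂ + 1) s₂ := by
  intro K
  rw [Function.iterate_add_apply, Function.iterate_one]
  change (step F)^[n₁ + n₂] (c₁ :: c₂ :: K, s) = _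
  rw [add_comm, Function.iterate_add_apply, h₁, h₂]

theorem Steps.loop {e : Expr} {c : Cmd} {s s₁ s₂ : State} {n₁ n₂ : ℕ} (he : e.val s ≠ 0)
    (h₁ : Steps F c s n₁ s₁) (h₂ : Steps F (.loop e c) s₁ n₂ s₂) :
    Steps F (.loop e c) s (n₁ + n₂ + 1) s₂ := by
  intro K
  rw [Function.iterate_add_apply, Function.iterate_one]
  simp only [step, if_pos he]
  rw [add_comm, Function.iterate_add_apply, h₁, h₂]

theorem Sim.mono {c : Cmd} {s : State} {m : Coin α} {t q t' q' : ℕ} {Q Q' : α → State → Prop}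
    (h : Sim F c s m t q Q) (ht : t ≤ t') (hq : q ≤ q') (hQ : ∀ a s', Q a s' → Q' a s') :
    Sim F c s m t' q' Q' := by
  obtain ⟨n, hn, s', h1, h2, h3, h4⟩ := h
  exact ⟨n, hn.trans ht, s', h1, h2, by omega, hQ _ _ h4⟩

theorem Sim.le {c : Cmd} {s : State} {m : Coin α} {t q t' q' : ℕ} {Q : α → State → Prop}
    (h : Sim F c s m t q Q) (ht : t ≤ t') (hq : q ≤ q') : Sim F c s m t' q' Q :=
  h.mono ht hq fun _ _ h => h

theorem Sim.bind {c₁ c₂ : Cmd} {s : State} {m : Coin α} {k : α → Coin β} {t₁ q₁ t₂ q₂ : ℕ}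
    {Q₁ : α → State → Prop} {Q : β → State → Prop} (h₁ : Sim F c₁ s m t₁ q₁ Q₁)
    (h₂ : ∀ a s₁, Q₁ a s₁ → Sim F c₂ s₁ (k a) t₂ q₂ Q) :
    Sim F (.seq c₁ c₂) s (m.bind k) (t₁ + t₂ + 1) (q₁ + q₂) Q := by
  obtain ⟨n₁, hn₁, s₁, hs₁, hc₁, hq₁, hQ₁⟩ := h₁
  obtain ⟨n₂, hn₂, s₂, hs₂, hc₂, hq₂, hQ₂⟩ := h₂ _ _ hQ₁
  rw [hc₁] at hc₂ hQ₂
  refine ⟨n₁ + n₂ + 1, by omega, s₂, hs₁.seq hs₂, ?_, by omega, ?_⟩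
  · rw [Coin.run_bind, hc₂]
  · rwa [Coin.run_bind]

/-- Sequential composition with a first part that tosses no coins. -/
theorem Sim.bind_ret {c₁ c₂ : Cmd} {s : State} {a : α} {m : Coin β} {t₁ q₁ t₂ q₂ : ℕ}
    {Q₁ : α → State → Prop} {Q : β → State → Prop} (h₁ : Sim F c₁ s (.ret a) t₁ q₁ Q₁)
    (h₂ : ∀ s₁, Q₁ a s₁ → Sim F c₂ s₁ m t₂ q₂ Q) :
    Sim F (.seq c₁ c₂) s m (t₁ + t₂ + 1) (q₁ + q₂) Q := by
  obtain ⟨n₁, hn₁, s₁, hs₁, hc₁, hq₁, hQ₁⟩ := h₁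
  obtain ⟨n₂, hn₂, s₂, hs₂, hc₂, hq₂, hQ₂⟩ := h₂ _ hQ₁
  rw [hc₁] at hc₂ hQ₂
  exact ⟨n₁ + n₂ + 1, by omega, s₂, hs₁.seq hs₂, hc₂, by omega, hQ₂⟩

/-- Sequential composition with a second part that tosses no coins and does not change the
result. -/
theorem Sim.seq_ret {c₁ c₂ : Cmd} {s : State} {m : Coin α} {t₁ q₁ t₂ q₂ : ℕ}
    {Q₁ : α → State → Prop} {Q : α → State → Prop} (h₁ : Sim F c₁ s m t₁ q₁ Q₁)
    (h₂ : ∀ a s₁, Q₁ a s₁ → Sim F c₂ s₁ (.ret a) t₂ q₂ Q) :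
    Sim F (.seq c₁ c₂) s m (t₁ + t₂ + 1) (q₁ + q₂) Q := by
  have := h₁.bind h₂
  rwa [Coin.bind_ret] at this

theorem Sim.skip {s : State} {a : α} {Q : α → State → Prop} (h : Q a s) :
    Sim F .skip s (.ret a) 1 0 Q :=
  ⟨1, le_rfl, s, fun _ => rfl, rfl, le_rfl, h⟩

theorem Sim.assign {r : ℕ} {e : Expr} {s : State} {a : α} {Q : α → State → Prop}
    (h : Q a { s with reg := Function.update s.reg r (e.val s) }) :
    Sim F (.assign r e) s (.ret a) 1 0 Q :=
  ⟨1, le_rfl, _, fun _ => rfl, rfl, le_rfl, h⟩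

theorem Sim.store {d e : Expr} {s : State} {a : α} {Q : α → State → Prop}
    (h : Q a { s with mem := Function.update s.mem (d.val s) (e.val s) }) :
    Sim F (.store d e) s (.ret a) 1 0 Q :=
  ⟨1, le_rfl, _, fun _ => rfl, rfl, le_rfl, h⟩

theorem Sim.query {src dst : Expr} {s : State} {a : α} {Q : α → State → Prop}
    (h : Q a { s with
      mem := writeBits s.mem (dst.val s) (F (readBits N s.mem (src.val s)))
      queries := s.queries + 1 }) :
    Sim F (.query src dst) s (.ret a) 1 1 Q :=
  ⟨1, le_rfl, _, fun _ => rfl, rfl, le_rfl, h⟩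

theorem Sim.flip {r : ℕ} {s : State} {k : Bool → α} {Q : α → State → Prop}
    (h : ∀ b, ∀ ω : ℕ → Bool,
      Q (k b) { s with reg := Function.update s.reg r b.toNat, coins := ω }) :
    Sim F (.flip r) s (.flip fun b => .ret (k b)) 1 0 Q :=
  ⟨1, le_rfl, _, fun _ => rfl, rfl, le_rfl, h _ _⟩

theorem Sim.ite_pos {e : Expr} {c₁ c₂ : Cmd} {s : State} {m : Coin α} {t q : ℕ}
    {Q : α → State → Prop} (he : e.val s ≠ 0) (h : Sim F c₁ s m t q Q) :
    Sim F (.ite e c₁ c₂) s m (t + 1) q Q := by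
  obtain ⟨n, hn, s', h1, h2⟩ := h
  refine ⟨n + 1, by omega, s', fun K => ?_, h2⟩
  rw [Function.iterate_succ_apply]
  simp only [step, if_pos he]
  exact h1 K

theorem Sim.ite_neg {e : Expr} {c₁ c₂ : Cmd} {s : State} {m : Coin α} {t q : ℕ}
    {Q : α → State → Prop} (he : e.val s = 0) (h : Sim F c₂ s m t q Q) :
    Sim F (.ite e c₁ c₂) s m (t + 1) q Q := by
  obtain ⟨n, hn, s', h1, h2⟩ := h
  refine ⟨n + 1, by omega, s', fun K => ?_, h2⟩
  rw [Function.iterate_succ_apply]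
  simp only [step, he, ne_eq, not_true_eq_false, if_false]
  exact h1 K

/-- The rule for loops with a known number `n` of rounds. -/
theorem Sim.loop {e : Expr} {c : Cmd} {s : State} {f : ℕ → α → Coin α} {a₀ : α} {n t q : ℕ}
    (Inv : ℕ → α → State → Prop) (h0 : Inv 0 a₀ s)
    (hpos : ∀ k < n, ∀ a s, Inv k a s → e.val s ≠ 0) (hzero : ∀ a s, Inv n a s → e.val s = 0)
    (hbody : ∀ k < n, ∀ a s, Inv k a s → Sim F c s (f k a) t q (Inv (k + 1))) :
    Sim F (.loop e c) s (Coin.iter f a₀ n) (n * (t + 1) + 1) (n * q) (Inv n) := by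
  -- The state after `j` rounds, from which the rest of the loop starts.
  have key : ∀ j ≤ n, ∃ s', Inv j ((Coin.iter f a₀ j).run s.coins).1 s' ∧
      s'.coins = ((Coin.iter f a₀ j).run s.coins).2 ∧ s'.queries ≤ s.queries + j * q ∧
      ∃ i ≤ j * (t + 1), ∀ n₂ s₂, Steps F (.loop e c) s' n₂ s₂ →
        Steps F (.loop e c) s (i + n₂) s₂ := by
    intro j
    induction j with
    | zero =>
      exact fun _ => ⟨s, h0, rfl, by omega, 0, by omega, fun n₂ s₂ h => by rwa [zero_add]⟩
    | succ j ih =>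
      intro hj
      obtain ⟨s', hI, hc, hq, i, hi, hs⟩ := ih (by omega)
      obtain ⟨n₁, hn₁, s₁, h1, h2, h3, h4⟩ := hbody j (by omega) _ _ hI
      rw [hc] at h2 h4
      refine ⟨s₁, ?_, ?_, ?_, i + (n₁ + 1), ?_, fun n₂ s₂ h => ?_⟩
      · rw [Coin.iter, Coin.run_bind]; exact h4
      · rw [Coin.iter, Coin.run_bind]; exact h2
      · rw [add_mul, one_mul]; omega
      · rw [add_mul j, one_mul]; omega
      · have := hs _ _ (Steps.loop (hpos j (by omega) _ _ hI) h1 h)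
        convert this using 1
        omega
  obtain ⟨s', hI, hc, hq, i, hi, hs⟩ := key n le_rfl
  refine ⟨i + 1, by omega, s', hs 1 s' fun K => ?_, hc, hq, hI⟩
  simp only [Function.iterate_one, step, hzero _ _ hI, ne_eq, not_true_eq_false, if_false]

/-- `for i := 0 to bound - 1 do c`, with the register `i` as counter. -/
def forLoop (i : ℕ) (bound : Expr) (c : Cmd) : Cmd :=
  .seq (.assign i (.const 0))
    (.loop (.sub bound (.reg i)) (.seq c (.assign i (.add (.reg i) (.const 1)))))

theorem Sim.forLoop {i : ℕ} {bound : Expr} {c : Cmd} {s : State} {f : ℕ → α → Coin α} {a₀ : α}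
    {n t q : ℕ} (Inv : ℕ → α → State → Prop)
    (h0 : Inv 0 a₀ { s with reg := Function.update s.reg i 0 })
    (hInv : ∀ k a s, Inv k a s → s.reg i = k ∧ bound.val s = n)
    (hbody : ∀ k < n, ∀ a s, Inv k a s → Sim F c s (f k a) t q fun a' s' =>
      s'.reg i = k ∧ Inv (k + 1) a' { s' with reg := Function.update s'.reg i (k + 1) }) :
    Sim F (forLoop i bound c) s (Coin.iter f a₀ n) (n * (t + 3) + 3) (n * q) (Inv n) := by
  refine ((Sim.assign (a := ()) (Q := fun _ s' => Inv 0 a₀ s') h0).bind_ret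
    fun s₁ h₁ => Sim.loop (n := n) (t := t + 2) (q := q) Inv h₁ ?_ ?_ ?_).le
      (by rw [mul_add, mul_add]; omega) (by omega)
  · intro k hk a s h
    have := hInv k a s h
    simp only [Expr.val]
    omega
  · intro a s h
    have := hInv n a s h
    simp only [Expr.val]
    omega
  · intro k hk a s h
    refine ((hbody k hk a s h).seq_ret fun a' s' h' => Sim.assign ?_).le (by omega) (by omega)
    simp only [Expr.val, h'.1]
    exact h'.2

/-- A run that ends within `T` steps. -/
theorem Sim.run_eq {A : Cmd} {q : ℕ} {ε δ : ℚ} {ω : ℕ → Bool} {m : Coin α} {T qb : ℕ}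
    {Q : α → State → Prop} (h : Sim F A (init N L q ε δ ω) m T qb Q) :
    (run A F q ε δ ω T).1 = [] ∧ (run A F q ε δ ω T).2.queries ≤ qb ∧
      Q (m.run ω).1 (run A F q ε δ ω T).2 := by
  obtain ⟨n, hn, s', h1, -, h3, h4⟩ := h
  have hfix : ∀ j, (step F)^[j] (([] : List Cmd), s') = ([], s') := fun j =>
    Function.iterate_fixed rfl j
  have : run A F q ε δ ω T = ([], s') := by
    rw [run, show T = (T - n) + n by omega, Function.iterate_add_apply, h1, hfix]
  rw [this]
  refine ⟨rfl, ?_, h4⟩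
  simpa [init] using h3

end OracleRAM

/-! ### Sampling -/

namespace Coin

/-- A uniform point of `{0,1}^N`, drawn bit by bit. -/
def point (N : ℕ) : Coin (Fin N → Bool) :=
  iter (fun i x => flip fun b => ret fun j => if j.val = i then b else x j) (fun _ => false) N

theorem ex_point {N : ℕ} (φ : (Fin N → Bool) → ℝ) : (point N).ex φ = cubeAvg φ := by
  -- After `n` rounds the first `n` coordinates are uniform.
  have key : ∀ n ≤ N, ∀ φ : (Fin N → Bool) → ℝ,
      (iter (fun i (x : Fin N → Bool) => flip fun b => ret fun j => if j.val = i then b else x j)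
        (fun _ => false) n).ex φ =
        cubeAvg fun x => φ fun j => if j.val < n then x j else false := by
    intro n
    induction n with
    | zero => intro _ φ; simp [iter, ex, cubeAvg_const]
    | succ n ih =>
      intro hn φ
      rw [ex_iter_succ, ih (by omega), cubeAvg_setAt ⟨n, hn⟩ fun x => φ _, ← cubeAvg_add,
        div_eq_inv_mul, ← cubeAvg_mul_left]
      congr 1
      funext x
      have h : ∀ b, (fun j : Fin N => if j.val = n then b else if j.val < n then x j else false) =
          fun j : Fin N => if j.val < n + 1 then setAt ⟨n, hn⟩ b x j else false := by
        intro b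
        funext j
        by_cases hj : j.val = n
        · have hj' : j = ⟨n, hn⟩ := Fin.ext hj
          subst hj'
          simp [setAt]
        · have hj' : j ≠ ⟨n, hn⟩ := fun h => hj (congrArg Fin.val h)
          have hlt : j.val < n + 1 ↔ j.val < n := by omega
          simp [setAt, hj, hj', hlt]
      simp only [ex, h]
      ring
  rw [point, key N le_rfl]
  simp

/-- A uniform natural number below `2 ^ n`, drawn bit by bit. -/
def number (n : ℕ) : Coin ℕ := iter (fun _ s => flip fun b => ret (s + s + b.toNat)) 0 n

theorem ex_number (n : ℕ) (φ : ℕ → ℝ) :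
    (number n).ex φ = (∑ s ∈ Finset.range (2 ^ n), φ s) / 2 ^ n := by
  have hpair : ∀ (m : ℕ) (φ : ℕ → ℝ), ∑ s ∈ Finset.range (2 * m), φ s =
      ∑ s ∈ Finset.range m, (φ (s + s) + φ (s + s + 1)) := by
    intro m φ
    induction m with
    | zero => simp
    | succ m ih =>
      rw [show 2 * (m + 1) = 2 * m + 1 + 1 by ring, Finset.sum_range_succ, Finset.sum_range_succ,
        ih, Finset.sum_range_succ, two_mul, add_assoc]
  induction n generalizing φ with
  | zero => simp [number, iter, ex]
  | succ n ih =>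
    rw [number, ex_iter_succ, ← number, ih, pow_succ' 2 n, hpair, pow_succ' (2 : ℝ) n,
      Finset.sum_div, Finset.sum_div]
    refine Finset.sum_congr rfl fun s _ => ?_
    simp only [ex, Bool.toNat_false, Bool.toNat_true, add_zero]
    field_simp

/-- The coordinatewise sum of `k` independent samples of a vector. -/
def tally {n : ℕ} (m : Coin (Fin n → ℕ)) (k : ℕ) : Coin (Fin n → ℕ) :=
  iter (fun _ c => m.bind fun v => ret fun j => c j + v j) (fun _ => 0) k

theorem ex_tally_sq {n : ℕ} (m : Coin (Fin n → ℕ)) (j : Fin n) {p : ℝ}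
    (h1 : (m.ex fun v => (v j : ℝ)) = p) (h2 : (m.ex fun v => (v j : ℝ) ^ 2) = p) (k : ℕ) (a : ℝ) :
    ((tally m k).ex fun c => ((c j : ℝ) - a) ^ 2) = (k * p - a) ^ 2 + k * (p - p ^ 2) := by
  induction k generalizing a with
  | zero => simp [tally, iter, ex]
  | succ k ih =>
    have hstep : ∀ c : Fin n → ℕ,
        ((m.bind fun v => ret fun j => c j + v j).ex fun c => ((c j : ℝ) - a) ^ 2) =
          ((c j : ℝ) - (a - p)) ^ 2 + (p - p ^ 2) := by
      intro c
      have : ∀ v : Fin n → ℕ, (((c j + v j : ℕ) : ℝ) - a) ^ 2 =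
          ((c j : ℝ) - a) ^ 2 + (2 * ((c j : ℝ) - a)) * (v j : ℝ) + (v j : ℝ) ^ 2 := by
        intro v; push_cast; ring
      simp only [ex_bind, ex, this]
      rw [ex_add, ex_add, ex_const, ex_mul_left, h1, h2]
      ring
    rw [tally, ex_iter_succ, ← tally]
    simp only [hstep]
    rw [ex_add, ex_const, ih]
    push_cast
    ring

end Coin

/-- The first place below `n` where `c` is largest. -/
def argmaxNat (c : ℕ → ℕ) : ℕ → ℕ
  | 0 => 0
  | n + 1 => if c (argmaxNat c n) < c n then n else argmaxNat c n

theorem argmaxNat_lt (c : ℕ → ℕ) {n : ℕ} (hn : 0 < n) : argmaxNat c n < n := by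
  induction n with
  | zero => omega
  | succ n ih =>
    unfold argmaxNat
    split_ifs
    · omega
    · rcases Nat.eq_zero_or_pos n with rfl | h
      · simp [argmaxNat]
      · have := ih h; omega

theorem le_argmaxNat (c : ℕ → ℕ) {n j : ℕ} (hj : j < n) : c j ≤ c (argmaxNat c n) := by
  induction n with
  | zero => omega
  | succ n ih =>
    unfold argmaxNat
    rcases Nat.lt_succ_iff_lt_or_eq.1 hj with h | rfl
    · have := ih h
      split_ifs <;> omega
    · split_ifs <;> omega

/-- The first index at which `c` is largest. -/
def argmaxFin {n : ℕ} (hn : 0 < n) (c : Fin n → ℕ) : Fin n :=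
  ⟨argmaxNat (fun j => if h : j < n then c ⟨j, h⟩ else 0) n, argmaxNat_lt _ hn⟩

theorem le_argmaxFin {n : ℕ} (hn : 0 < n) (c : Fin n → ℕ) (j : Fin n) :
    c j ≤ c (argmaxFin hn c) := by
  have := le_argmaxNat (fun j => if h : j < n then c ⟨j, h⟩ else 0) j.2
  simpa [argmaxFin, argmaxNat_lt _ hn] using this

open Classical in
/-- Chebyshev's inequality for the choice of the largest of several empirical means of indicator
variables. The variance of such a mean is at most its expectation, so the union bound over the
coordinates costs the sum `S` of the expectations and not their number. -/
theorem Coin.ex_tally_argmax {n : ℕ} (hn : 0 < n) (m : Coin (Fin n → ℕ)) {p : Fin n → ℝ}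
    (h1 : ∀ j, (m.ex fun v => (v j : ℝ)) = p j) (h2 : ∀ j, (m.ex fun v => (v j : ℝ) ^ 2) = p j)
    {S γ : ℝ} (hS : ∑ j, p j ≤ S) (hγ : 0 < γ) (hj : ∃ j, γ ≤ p j) {k : ℕ}
    (hk : 64 * S ≤ k * γ ^ 2) (hk0 : 0 < k) :
    ((tally m k).ex fun c => if p (argmaxFin hn c) ≤ γ / 2 then 1 else 0) ≤ 1 / 4 := by
  obtain ⟨j₀, hj₀⟩ := hj
  have hk' : (0 : ℝ) < k := Nat.cast_pos.2 hk0
  have hpt : ∀ c : Fin n → ℕ, (k * γ) ^ 2 * (if p (argmaxFin hn c) ≤ γ / 2 then 1 else 0) ≤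
      ∑ j, 16 * ((c j : ℝ) - k * p j) ^ 2 := by
    intro c
    have hnn : ∀ j ∈ Finset.univ, 0 ≤ 16 * ((c j : ℝ) - k * p j) ^ 2 := fun j _ => by positivity
    split_ifs with hp
    · -- Either the count of `j₀` is too low or the count of the chosen index is too high.
      have hmax : (c j₀ : ℝ) ≤ c (argmaxFin hn c) := Nat.cast_le.2 (le_argmaxFin hn c j₀)
      have hkg : 0 < k * γ := mul_pos hk' hγ
      have e1 : k * γ ≤ k * p j₀ := mul_le_mul_of_nonneg_left hj₀ hk'.le
      have e2 : k * p (argmaxFin hn c) ≤ k * (γ / 2) := mul_le_mul_of_nonneg_left hp hk'.le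
      rw [mul_one]
      by_cases hlow : (c j₀ : ℝ) ≤ k * p j₀ - k * γ / 4
      · refine le_trans ?_ (Finset.single_le_sum hnn (Finset.mem_univ j₀))
        nlinarith
      · refine le_trans ?_ (Finset.single_le_sum hnn (Finset.mem_univ (argmaxFin hn c)))
        nlinarith
    · rw [mul_zero]
      exact Finset.sum_nonneg hnn
  have hex := ex_mono (tally m k) hpt
  rw [ex_mul_left, ex_sum] at hex
  have hsum : ∑ j, (tally m k).ex (fun c => 16 * ((c j : ℝ) - k * p j) ^ 2) ≤ 16 * (k * S) := by
    calc _ = ∑ j, 16 * (k * (p j - p j ^ 2)) := by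
          refine Finset.sum_congr rfl fun j _ => ?_
          rw [ex_mul_left, ex_tally_sq m j (h1 j) (h2 j)]
          ring
      _ ≤ ∑ j, 16 * (k * p j) := Finset.sum_le_sum fun j _ => by
          have := mul_nonneg hk'.le (sq_nonneg (p j))
          nlinarith
      _ = 16 * (k * ∑ j, p j) := by simp only [Finset.mul_sum]
      _ ≤ _ := by gcongr
  have hpos : 0 < (k * γ) ^ 2 := by positivity
  have hfin : (k * γ) ^ 2 * ((tally m k).ex fun c => if p (argmaxFin hn c) ≤ γ / 2 then 1 else 0) ≤
      (k * γ) ^ 2 * (1 / 4) := by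
    refine hex.trans (hsum.trans ?_)
    nlinarith [mul_le_mul_of_nonneg_left hk hk'.le]
  exact le_of_mul_le_mul_left hfin hpos

/-! ### The randomized search -/

namespace Coin

variable {N L : ℕ}

/-- The outputs at which two independent uniform points, overwritten by `g`, differ. -/
def pairSample (F : (Fin N → Bool) → (Fin L → Bool)) (g : PartialAssignment N) :
    Coin (Fin L → ℕ) :=
  (point N).bind fun x => (point N).bind fun y =>
    ret fun t => if F (g.patch x) t ≠ F (g.patch y) t then 1 else 0

/-- The coordinates to which the output `t` is sensitive at a uniform point overwritten by `g`. -/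
def flipSample (F : (Fin N → Bool) → (Fin L → Bool)) (g : PartialAssignment N) (t : Fin L) :
    Coin (Fin N → ℕ) :=
  (point N).bind fun x =>
    ret fun i => if F (g.patch x) t ≠ F (g.patch (flipAt i x)) t then 1 else 0

/-- One stage of the search: estimate the variance of every output from `k₁` samples and choose the
largest one, estimate the influences on that output from `k₂` samples and choose the largest one,
and assign a random bit to the chosen coordinate. -/
def stage (F : (Fin N → Bool) → (Fin L → Bool)) (hN : 0 < N) (hL : 0 < L) (k₁ k₂ : ℕ)
    (g : PartialAssignment N) : Coin (PartialAssignment N) :=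
  (tally (pairSample F g) k₁).bind fun c =>
    (tally (flipSample F g (argmaxFin hL c)) k₂).bind fun c' =>
      flip fun b => ret (g.fix (argmaxFin hN c') b)

/-- A random number of stages, starting from the nowhere defined assignment. -/
def search (F : (Fin N → Bool) → (Fin L → Bool)) (hN : 0 < N) (hL : 0 < L) (k₁ k₂ n : ℕ) :
    Coin (PartialAssignment N) :=
  (number n).bind fun s => iter (fun _ => stage F hN hL k₁ k₂) (fun _ => none) s

variable {F : (Fin N → Bool) → (Fin L → Bool)}

theorem ex_pairSample (g : PartialAssignment N) (t : Fin L) :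
    ((pairSample F g).ex fun v => (v t : ℝ)) =
        cubeDis (fun x => F (g.patch x) t) (fun x => F (g.patch x) t) ∧
      ((pairSample F g).ex fun v => (v t : ℝ) ^ 2) =
        cubeDis (fun x => F (g.patch x) t) (fun x => F (g.patch x) t) := by
  simp only [pairSample, ex_bind, ex_point, ex, cubeDis, neInd, Nat.cast_ite, Nat.cast_one,
    Nat.cast_zero, ite_pow, one_pow, ne_eq, OfNat.ofNat_ne_zero, not_false_eq_true, zero_pow,
    and_self]

theorem ex_flipSample (g : PartialAssignment N) (t : Fin L) (i : Fin N) :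
    ((flipSample F g t).ex fun v => (v i : ℝ)) = infl i (fun x => F (g.patch x) t) ∧
      ((flipSample F g t).ex fun v => (v i : ℝ) ^ 2) = infl i (fun x => F (g.patch x) t) := by
  simp only [flipSample, ex_bind, ex_point, ex, infl, neInd, Nat.cast_ite, Nat.cast_one,
    Nat.cast_zero, ite_pow, one_pow, ne_eq, OfNat.ofNat_ne_zero, not_false_eq_true, zero_pow,
    and_self]

theorem ex_stage_potential (hN : 0 < N) (hL : 0 < L) (k₁ k₂ : ℕ) (g : PartialAssignment N) :
    (stage F hN hL k₁ k₂ g).ex (potential F) = potential F g -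
      (tally (pairSample F g) k₁).ex fun c =>
        (tally (flipSample F g (argmaxFin hL c)) k₂).ex fun c' =>
          sumInfl F g (argmaxFin hN c') := by
  simp only [stage, ex_bind, ex, potential_fix, ex_sub, ex_const]

open Classical in
/-- A stage never raises the potential on average, and lowers it by at least `1 / (4 * q * E)` if
some output still has a large variance. The numbers of samples are such that each of the two choices
fails with probability at most `1 / 4`, and a coordinate chosen well has influence more than
`1 / (2 * q * E)` on the chosen output. -/
theorem ex_stage_potential_le {q E : ℕ} (hF : ∀ t, DTree.Computes q fun x => F x t) (hN : 0 < N)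
    (hL : 0 < L) (hq : 0 < q) (hE : 0 < E) {ε : ℝ} (hε : 1 / (E : ℝ) ≤ ε)
    (g : PartialAssignment N) :
    (stage F hN hL (L * (64 * (q * E) ^ 3)) (64 * (q * E) ^ 3) g).ex (potential F) ≤
      potential F g - 1 / (4 * q * E) * (if SmallVariance F ε g then 0 else 1) := by
  rw [ex_stage_potential]
  set k₂ := 64 * (q * E) ^ 3 with hk₂
  have hWnn : ∀ c, 0 ≤ (tally (flipSample F g (argmaxFin hL c)) k₂).ex fun c' =>
      sumInfl F g (argmaxFin hN c') := fun c =>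
    (ex_const _ 0).symm.le.trans (ex_mono _ fun c' => sumInfl_nonneg g _)
  have hq' : (1 : ℝ) ≤ q := by exact_mod_cast hq
  have hE' : (1 : ℝ) ≤ E := by exact_mod_cast hE
  have hL' : (1 : ℝ) ≤ L := by exact_mod_cast hL
  have hu : (1 : ℝ) ≤ q * E := one_le_mul_of_one_le_of_one_le hq' hE'
  have hk₂pos : 0 < k₂ := by positivity
  split_ifs with hg
  · rw [mul_zero]
    refine sub_le_sub_left ?_ _
    exact (ex_const _ 0).symm.le.trans (ex_mono _ hWnn)
  rw [mul_one]
  refine sub_le_sub_left ?_ _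
  simp only [smallVariance_iff, not_forall, not_le] at hg
  obtain ⟨t₀, ht₀⟩ := hg
  have hbad1 := ex_tally_argmax hL (pairSample F g) (fun t => (ex_pairSample g t).1)
    (fun t => (ex_pairSample g t).2) (S := L) (γ := 1 / E) (k := L * k₂)
    ((Finset.sum_le_sum fun t _ => cubeDis_le_one _ _).trans (by simp)) (by positivity)
    ⟨t₀, hε.trans ht₀.le⟩ (by
      have h : (64 : ℝ) ≤ 64 * (q ^ 3 * E) := by
        nlinarith [one_le_mul_of_one_le_of_one_le (one_le_pow₀ hq' (n := 3)) hE']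
      have e : ((L * k₂ : ℕ) : ℝ) * (1 / E) ^ 2 = L * (64 * (q ^ 3 * E)) := by
        rw [hk₂]; push_cast; field_simp
      rw [e]
      nlinarith) (by positivity)
  have hinner : ∀ c, 3 / 4 * (1 / (2 * q * E)) * (1 - if cubeDis
        (fun x => F (g.patch x) (argmaxFin hL c)) (fun x => F (g.patch x) (argmaxFin hL c)) ≤
          1 / E / 2 then 1 else 0) ≤
      (tally (flipSample F g (argmaxFin hL c)) k₂).ex fun c' =>
        sumInfl F g (argmaxFin hN c') := by
    intro c
    split_ifs with hc
    · simpa using hWnn c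
    set t := argmaxFin hL c
    obtain ⟨i, hi⟩ := ((hF t).comp_patch g).exists_infl (a := 1 / E / 2) (by positivity)
      (not_le.1 hc)
    have hbad2 := ex_tally_argmax hN (flipSample F g t) (fun i => (ex_flipSample g t i).1)
      (fun i => (ex_flipSample g t i).2) (S := q) (γ := 1 / (q * E)) (k := k₂)
      ((hF t).comp_patch g).totalInfl_le (by positivity)
      ⟨i, by
        rw [div_le_iff₀ (by positivity)]
        have h2 : 1 < q * infl i (fun x => F (g.patch x) t) * E := by
          have : 2 * (1 / (E : ℝ) / 2) = 1 / E := by ring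
          rwa [this, div_lt_iff₀ (by positivity)] at hi
        linarith⟩ (by
        have e : ((k₂ : ℕ) : ℝ) * (1 / (q * E)) ^ 2 = 64 * (q * E) := by
          rw [hk₂]; push_cast; field_simp
        rw [e]
        nlinarith) hk₂pos
    have hpt : ∀ c' : Fin N → ℕ, 1 / (2 * q * E) * (1 - if infl (argmaxFin hN c')
        (fun x => F (g.patch x) t) ≤ 1 / (q * E) / 2 then 1 else 0) ≤
        sumInfl F g (argmaxFin hN c') := by
      intro c'
      split_ifs with hc'
      · simpa using sumInfl_nonneg g _
      · refine le_trans ?_ (infl_le_sumInfl g _ t)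
        have : 1 / (2 * q * E : ℝ) = 1 / (q * E) / 2 := by field_simp
        rw [sub_zero, mul_one, this]
        exact (not_le.1 hc').le
    have h := ex_mono (tally (flipSample F g t) k₂) hpt
    rw [ex_mul_left, ex_sub, ex_const] at h
    refine le_trans ?_ h
    have : 0 ≤ 1 / (2 * q * E : ℝ) := by positivity
    nlinarith
  have h := ex_mono (tally (pairSample F g) (L * k₂)) hinner
  rw [ex_mul_left, ex_sub, ex_const] at h
  refine le_trans ?_ h
  have e : 1 / (4 * q * E : ℝ) = 1 / 2 * (1 / (2 * q * E)) := by field_simp; norm_num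
  have : 0 ≤ 1 / (2 * q * E : ℝ) := by positivity
  rw [e]
  nlinarith

open Classical in
/-- Stopping after a random number of stages: the potential pays for each stage at which some
variance is large, so the expected number of such stages is at most `4 * L * q ^ 2 * E`. -/
theorem ex_search {q E : ℕ} (hF : ∀ t, DTree.Computes q fun x => F x t) (hN : 0 < N)
    (hL : 0 < L) (hq : 0 < q) (hE : 0 < E) {ε δ : ℝ} (hε : 1 / (E : ℝ) ≤ ε) {n : ℕ}
    (hn : 4 * L * q ^ 2 * E ≤ δ * 2 ^ n) :
    1 - δ ≤ (search F hN hL (L * (64 * (q * E) ^ 3)) (64 * (q * E) ^ 3) n).ex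
      fun g => if SmallVariance F ε g then 1 else 0 := by
  set k₂ := 64 * (q * E) ^ 3
  set P : ℕ → Coin (PartialAssignment N) :=
    fun s => iter (fun _ => stage F hN hL (L * k₂) k₂) (fun _ => none) s with hP
  set bad : PartialAssignment N → ℝ := fun g => if SmallVariance F ε g then 0 else 1 with hbad
  have hpot : ∀ s, (P s).ex (potential F) +
      1 / (4 * q * E) * ∑ s' ∈ Finset.range s, (P s').ex bad ≤ L * q := by
    intro s
    induction s with
    | zero => simpa [hP, iter, ex] using potential_le hF _
    | succ s ih =>
      have h := ex_mono (P s) fun g => ex_stage_potential_le hF hN hL hq hE hε g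
      rw [ex_sub, ex_mul_left] at h
      have e : (P (s + 1)).ex (potential F) = (P s).ex fun g =>
        (stage F hN hL (L * k₂) k₂ g).ex (potential F) := ex_iter_succ _ _ _ _
      rw [Finset.sum_range_succ, mul_add, e]
      linarith
  have hnn : 0 ≤ (P (2 ^ n)).ex (potential F) :=
    (ex_const _ 0).symm.le.trans (ex_mono _ fun g => potential_nonneg g)
  have hq' : (0 : ℝ) < q := Nat.cast_pos.2 hq
  have hE' : (0 : ℝ) < E := Nat.cast_pos.2 hE
  have hsum : ∑ s ∈ Finset.range (2 ^ n), (P s).ex bad ≤ δ * 2 ^ n := by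
    have h : 1 / (4 * q * E : ℝ) * ∑ s ∈ Finset.range (2 ^ n), (P s).ex bad ≤ L * q := by
      linarith [hpot (2 ^ n)]
    rw [one_div, inv_mul_le_iff₀ (by positivity)] at h
    nlinarith
  have hgood : ∀ s, ((P s).ex fun g => if SmallVariance F ε g then (1 : ℝ) else 0) =
      1 - (P s).ex bad := by
    intro s
    rw [← ex_const (P s) 1, ← ex_sub, ex_const]
    congr 1
    funext g
    simp only [hbad]
    split_ifs <;> norm_num
  rw [search, ex_bind, ex_number]
  change 1 - δ ≤ (∑ s ∈ Finset.range (2 ^ n),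
    (P s).ex fun g => if SmallVariance F ε g then (1 : ℝ) else 0) / 2 ^ n
  simp only [hgood, Finset.sum_sub_distrib, Finset.sum_const, Finset.card_range, nsmul_eq_mul,
    mul_one]
  push_cast
  rw [le_div_iff₀ (by positivity)]
  linarith

end Coin

/-! ### The program: sampling and counting -/

namespace OracleRAM

variable {N L : ℕ} {F : (Fin N → Bool) → (Fin L → Bool)} {α β : Type}

theorem Sim.flip_seq {r : ℕ} {c : Cmd} {s : State} {k : Bool → Coin α} {t q : ℕ}
    {Q : α → State → Prop}
    (h : ∀ b, ∀ ω : ℕ → Bool,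
      Sim F c { s with reg := Function.update s.reg r b.toNat, coins := ω } (k b) t q Q) :
    Sim F (.seq (.flip r) c) s (.flip k) (t + 2) q Q := by
  have h' := Sim.bind (k := k) (Sim.flip (F := F) (r := r) (s := s) (k := fun b => b)
    (Q := fun b s' => Sim F c s' (k b) t q Q) h) fun a s₁ h₁ => h₁
  exact Sim.le h' (by omega) (by omega)

theorem Sim.assign_seq {r : ℕ} {e : Expr} {c : Cmd} {s : State} {m : Coin α} {t q : ℕ}
    {Q : α → State → Prop}
    (h : Sim F c { s with reg := Function.update s.reg r (e.val s) } m t q Q) :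
    Sim F (.seq (.assign r e) c) s m (t + 2) q Q :=
  ((Sim.assign (a := ()) (Q := fun _ s' => Sim F c s' m t q Q) h).bind_ret fun _ h₁ => h₁).le
    (by omega) (by omega)

theorem Sim.store_seq {d e : Expr} {c : Cmd} {s : State} {m : Coin α} {t q : ℕ}
    {Q : α → State → Prop}
    (h : Sim F c { s with mem := Function.update s.mem (d.val s) (e.val s) } m t q Q) :
    Sim F (.seq (.store d e) c) s m (t + 2) q Q :=
  ((Sim.store (a := ()) (Q := fun _ s' => Sim F c s' m t q Q) h).bind_ret fun _ h₁ => h₁).le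
    (by omega) (by omega)

theorem writeBits_of_lt (m : ℕ → ℕ) (a : ℕ) (y : Fin L → Bool) (t : Fin L) :
    writeBits m a y (a + t) = (y t).toNat := by
  simp [writeBits]

theorem writeBits_of_notMem (m : ℕ → ℕ) {a : ℕ} (y : Fin L → Bool) {k : ℕ}
    (h : k < a ∨ a + L ≤ k) : writeBits m a y k = m k := by
  rw [writeBits, dif_neg]
  omega

theorem readBits_eq {m : ℕ → ℕ} {a : ℕ} {x : Fin N → Bool}
    (h : ∀ j : Fin N, m (a + j) = (x j).toNat) : readBits N m a = x := by
  funext j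
  rw [readBits, h]
  cases x j <;> rfl

/-- The memory cell that stands for a value of a partial assignment. -/
def cell : Option Bool → ℕ
  | none => 0
  | some b => 1 + b.toNat

/-- The cells from address `0` on hold the partial assignment `g`. -/
def Holds (g : PartialAssignment N) (s : State) : Prop := ∀ j : Fin N, s.mem j = cell (g j)

theorem Holds.output_eq {g : PartialAssignment N} {s : State} (h : Holds g s) :
    output N s = g := by
  funext j
  rw [output, h]
  rcases g j with _ | _ | _ <;> rfl

/-- Write a uniform point, overwritten by the current assignment, to the `N` cells from address `N`
on. -/
def sampleCmd : Cmd :=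
  forLoop 30 (.reg 0) (.seq (.flip 31) (.ite (.mem (.reg 30))
    (.store (.add (.reg 0) (.reg 30)) (.sub (.mem (.reg 30)) (.const 1)))
    (.store (.add (.reg 0) (.reg 30)) (.reg 31))))

theorem sim_sampleCmd {g : PartialAssignment N} {s : State} (hN : s.reg 0 = N) (hg : Holds g s) :
    Sim F sampleCmd s (Coin.point N) (7 * N + 3) 0 fun x s' =>
      (∀ r < 30, s'.reg r = s.reg r) ∧ (∀ a, a < N ∨ N + N ≤ a → s'.mem a = s.mem a) ∧
        ∀ j : Fin N, s'.mem (N + j) = (g.patch x j).toNat := by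
  refine ((Sim.forLoop (n := N) (t := 4) (q := 0) (fun k x s' => s'.reg 30 = k ∧
    (∀ r < 30, s'.reg r = s.reg r) ∧ (∀ a, a < N ∨ N + N ≤ a → s'.mem a = s.mem a) ∧
      ∀ j : Fin N, j.val < k → s'.mem (N + j) = (g.patch x j).toNat) ?_ ?_ ?_).le
        (by omega) (by omega)).mono le_rfl le_rfl ?_
  · refine ⟨by simp, fun r hr => ?_, fun _ _ => rfl, fun j hj => by omega⟩
    simp [Function.update_of_ne (show r ≠ 30 by omega)]
  · rintro k x s' ⟨h1, h2, -⟩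
    exact ⟨h1, by simp [Expr.val, h2, hN]⟩
  · rintro k hk x s' ⟨h1, h2, h3, h4⟩
    have h0 : s'.reg 0 = N := by rw [h2 0 (by norm_num), hN]
    have hmem : s'.mem k = cell (g ⟨k, hk⟩) := by rw [h3 k (Or.inl hk)]; exact hg ⟨k, hk⟩
    refine Sim.flip_seq (t := 2) fun b ω => ?_
    -- Both branches store the value at `k` of the overwritten point.
    have hpost : ∀ s'' : State, s''.reg = Function.update s'.reg 31 b.toNat →
        s''.mem = Function.update s'.mem (N + k) ((g ⟨k, hk⟩).getD b).toNat →
        s''.reg 30 = k ∧ Function.update s''.reg 30 (k + 1) 30 = k + 1 ∧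
          (∀ r < 30, Function.update s''.reg 30 (k + 1) r = s.reg r) ∧
          (∀ a, a < N ∨ N + N ≤ a → s''.mem a = s.mem a) ∧ ∀ j : Fin N, j.val < k + 1 →
            s''.mem (N + j) = (g.patch (fun j => if j.val = k then b else x j) j).toNat := by
      intro s'' hr hm
      refine ⟨by simp [hr, h1], by simp, fun r hr' => ?_, fun a ha => ?_, fun j hj => ?_⟩
      · simp [hr, Function.update_of_ne (show r ≠ 30 by omega),
          Function.update_of_ne (show r ≠ 31 by omega), h2 r hr']
      · rw [hm, Function.update_of_ne (by omega), h3 a ha]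
      · by_cases hjk : j.val = k
        · have : j = ⟨k, hk⟩ := Fin.ext hjk
          subst this
          simp [hm, PartialAssignment.patch]
        · rw [hm, Function.update_of_ne (by omega), h4 j (by omega)]
          simp [PartialAssignment.patch, hjk]
    rcases hgk : g ⟨k, hk⟩ with _ | b'
    · rw [hgk] at hmem
      refine (Sim.ite_neg ?_ (Sim.store (hpost _ rfl ?_)))
      · simp [Expr.val, h1, hmem, cell]
      · simp [Expr.val, h1, h0, hgk]
    · rw [hgk] at hmem
      refine (Sim.ite_pos ?_ (Sim.store (hpost _ rfl ?_)))
      · simp [Expr.val, h1, hmem, cell]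
      · simp [Expr.val, h1, h0, hgk, hmem, cell]
  · rintro x s' ⟨-, h2, h3, h4⟩
    exact ⟨h2, h3, fun j => h4 j j.2⟩


/-- Write `0` to the `b` cells from the address in register `17` on. -/
def zeroCmd (b : Expr) : Cmd :=
  forLoop 21 b (.store (.add (.reg 17) (.reg 21)) (.const 0))

theorem sim_zeroCmd {r₀ n : ℕ} (hr₀ : r₀ < 20) {s : State} (hn : s.reg r₀ = n) :
    Sim F (zeroCmd (.reg r₀)) s (.ret ()) (4 * n + 3) 0 fun _ s' =>
      (∀ r < 20, s'.reg r = s.reg r) ∧ (∀ a, a < s.reg 17 → s'.mem a = s.mem a) ∧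
        ∀ j < n, s'.mem (s.reg 17 + j) = 0 := by
  rw [← Coin.iter_ret () n]
  refine ((Sim.forLoop (n := n) (t := 1) (q := 0) (fun k _ s' => s'.reg 21 = k ∧
    (∀ r < 20, s'.reg r = s.reg r) ∧ (∀ a, a < s.reg 17 → s'.mem a = s.mem a) ∧
      ∀ j < k, s'.mem (s.reg 17 + j) = 0) ?_ ?_ ?_).le
        (by omega) (by omega)).mono le_rfl le_rfl ?_
  · refine ⟨by simp, fun r hr => ?_, fun _ _ => rfl, fun j hj => by omega⟩
    simp [Function.update_of_ne (show r ≠ 21 by omega)]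
  · rintro k x s' ⟨h1, h2, -⟩
    exact ⟨h1, by simp [Expr.val, h2 r₀ hr₀, hn]⟩
  · rintro k hk x s' ⟨h1, h2, h3, h4⟩
    refine Sim.store ⟨h1, by simp, fun r hr => ?_, fun a ha => ?_, fun j hj => ?_⟩
    · simp [Function.update_of_ne (show r ≠ 21 by omega), h2 r hr]
    · simp only [Expr.val, h1, h2 17 (by norm_num)]
      rw [Function.update_of_ne (by omega), h3 a ha]
    · simp only [Expr.val, h1, h2 17 (by norm_num)]
      by_cases hjk : j = k
      · simp [hjk]
      · rw [Function.update_of_ne (by omega), h4 j (by omega)]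
  · rintro x s' ⟨-, h⟩
    exact h

/-- Set register `25` to the first place where the array of length `b` that starts at the address
in register `17` is largest. -/
def argmaxCmd (b : Expr) : Cmd :=
  .seq (.assign 25 (.const 0)) (forLoop 24 b
    (.ite (.sub (.mem (.add (.reg 17) (.reg 24))) (.mem (.add (.reg 17) (.reg 25))))
      (.assign 25 (.reg 24)) .skip))

theorem argmaxNat_congr {c c' : ℕ → ℕ} {n : ℕ} (h : ∀ j < n, c j = c' j) :
    argmaxNat c n = argmaxNat c' n := by
  induction n with
  | zero => rfl
  | succ n ih =>
    have e := ih fun j hj => h j (by omega)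
    have h' : c (argmaxNat c' n) = c' (argmaxNat c' n) := by
      rcases Nat.eq_zero_or_pos n with rfl | hn
      · exact h 0 (by omega)
      · have := argmaxNat_lt c' hn
        exact h _ (by omega)
    simp only [argmaxNat, e, h', h n (by omega)]

theorem sim_argmaxCmd {r₀ n : ℕ} (hr₀ : r₀ < 20) {s : State} (hn : s.reg r₀ = n) (hn0 : 0 < n)
    {c : Fin n → ℕ} (hc : ∀ j : Fin n, s.mem (s.reg 17 + j) = c j) :
    Sim F (argmaxCmd (.reg r₀)) s (.ret ()) (5 * n + 5) 0 fun _ s' =>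
      (∀ r < 20, s'.reg r = s.reg r) ∧ s'.mem = s.mem ∧ s'.reg 25 = argmaxFin hn0 c := by
  rw [← Coin.iter_ret () n]
  refine (Sim.assign_seq ((Sim.forLoop (n := n) (t := 2) (q := 0) (fun k _ s' => s'.reg 24 = k ∧
    (∀ r < 20, s'.reg r = s.reg r) ∧ s'.mem = s.mem ∧
      s'.reg 25 = argmaxNat (fun j => s.mem (s.reg 17 + j)) k) ?_ ?_ ?_))).mono
        (by omega) (by omega) ?_
  · refine ⟨by simp, fun r hr => ?_, rfl, by simp [argmaxNat, Expr.val]⟩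
    simp [Function.update_of_ne (show r ≠ 24 by omega),
      Function.update_of_ne (show r ≠ 25 by omega)]
  · rintro k x s' ⟨h1, h2, -⟩
    exact ⟨h1, by simp [Expr.val, h2 r₀ hr₀, hn]⟩
  · rintro k hk x s' ⟨h1, h2, h3, h4⟩
    have h17 := h2 17 (by norm_num)
    by_cases hlt : s.mem (s.reg 17 + argmaxNat (fun j => s.mem (s.reg 17 + j)) k) <
        s.mem (s.reg 17 + k)
    · refine Sim.ite_pos ?_ (Sim.assign ⟨by simp [h1], by simp, fun r hr => ?_, h3, ?_⟩)
      · simp only [Expr.val, h17, h3, h1, h4]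
        omega
      · simp [Function.update_of_ne (show r ≠ 24 by omega),
          Function.update_of_ne (show r ≠ 25 by omega), h2 r hr]
      · simp [argmaxNat, hlt, Expr.val, h1]
    · refine Sim.ite_neg ?_ (Sim.skip ⟨by simp [h1], by simp, fun r hr => ?_, h3, ?_⟩)
      · simp only [Expr.val, h17, h3, h1, h4]
        omega
      · simp [Function.update_of_ne (show r ≠ 24 by omega), h2 r hr]
      · simp [argmaxNat, hlt, h4]
  · rintro x s' ⟨-, h1, h2, h3⟩
    refine ⟨h1, h2, h3.trans (argmaxNat_congr fun j hj => ?_)⟩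
    rw [dif_pos hj]
    exact hc ⟨j, hj⟩

end OracleRAM

/-! ### The program: one stage of the search -/

namespace OracleRAM

variable {N L : ℕ} {F : (Fin N → Bool) → (Fin L → Bool)} {k₁ k₂ : ℕ} {g : PartialAssignment N}
  {s : State}

/-- The memory layout during the search. The current assignment is in the `N` cells from address
`0` on, the argument of the next query in the `N` cells that follow, then come two blocks of `L`
cells for the answers to queries (at the addresses in registers `15` and `16`), and then the counts
(at the address in register `17`). Registers `10` and `11` hold the numbers of samples.

The commands of a stage leave this layout alone: registers below `18` hold parameters, and a command
in the body of a loop changes only registers above the counter of that loop. -/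
structure Layout (L k₁ k₂ : ℕ) (g : PartialAssignment N) (s : State) : Prop where
  reg0 : s.reg 0 = N
  reg1 : s.reg 1 = L
  reg10 : s.reg 10 = k₂
  reg11 : s.reg 11 = k₁
  reg15 : s.reg 15 = N + N
  reg16 : s.reg 16 = N + N + L
  reg17 : s.reg 17 = N + N + L + L
  holds : Holds g s

theorem Layout.of_eq {s' : State} (h : Layout L k₁ k₂ g s) (hr : ∀ r < 18, s'.reg r = s.reg r)
    (hm : ∀ a < N, s'.mem a = s.mem a) : Layout L k₁ k₂ g s' := by
  obtain ⟨h0, h1, h2, h3, h4, h5, h6, h7⟩ := h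
  constructor <;> first | rwa [hr _ (by norm_num)] | skip
  intro j
  rw [hm j j.2, h7]

/-- The distance of two numbers. -/
def distExpr (e₁ e₂ : Expr) : Expr := .add (.sub e₁ e₂) (.sub e₂ e₁)

theorem val_distExpr {e₁ e₂ : Expr} {a b : Bool} (h₁ : e₁.val s = a.toNat)
    (h₂ : e₂.val s = b.toNat) : (distExpr e₁ e₂).val s = if a ≠ b then 1 else 0 := by
  simp only [distExpr, Expr.val, h₁, h₂]
  cases a <;> cases b <;> rfl

theorem sim_query_reg {r a : ℕ} {x : Fin N → Bool} (h0 : s.reg 0 = N) (hr : s.reg r = a)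
    (hx : ∀ j : Fin N, s.mem (N + j) = (x j).toNat) :
    Sim F (.query (.reg 0) (.reg r)) s (.ret ()) 1 1 fun _ s' => s'.reg = s.reg ∧
      (∀ b, b < a ∨ a + L ≤ b → s'.mem b = s.mem b) ∧
        ∀ t : Fin L, s'.mem (a + t) = (F x t).toNat := by
  refine Sim.query ⟨rfl, ?_, ?_⟩ <;> simp only [Expr.val, h0, hr, readBits_eq hx]
  · exact fun b hb => writeBits_of_notMem _ _ hb
  · exact fun t => writeBits_of_lt _ _ _ t

/-- Increase the count of every output at which the two answers in memory differ. -/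
def compareCmd : Cmd :=
  forLoop 23 (.reg 1) (.store (.add (.reg 17) (.reg 23))
    (.add (.mem (.add (.reg 17) (.reg 23))) (distExpr (.mem (.add (.reg 15) (.reg 23)))
      (.mem (.add (.reg 16) (.reg 23))))))

theorem sim_compareCmd (h : Layout L k₁ k₂ g s) {c : Fin L → ℕ} {y z : Fin L → Bool}
    (hc : ∀ t : Fin L, s.mem (N + N + L + L + t) = c t)
    (hy : ∀ t : Fin L, s.mem (N + N + t) = (y t).toNat)
    (hz : ∀ t : Fin L, s.mem (N + N + L + t) = (z t).toNat) :
    Sim F compareCmd s (.ret fun t => c t + if y t ≠ z t then 1 else 0) (4 * L + 3) 0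
      fun c' s' => (∀ r < 23, s'.reg r = s.reg r) ∧ (∀ a < N, s'.mem a = s.mem a) ∧
        ∀ t : Fin L, s'.mem (N + N + L + L + t) = c' t := by
  rw [← Coin.iter_ret _ L]
  refine ((Sim.forLoop (n := L) (t := 1) (q := 0) (fun k c' s' => s'.reg 23 = k ∧
    (c' = fun t => c t + if y t ≠ z t then 1 else 0) ∧
    (∀ r < 23, s'.reg r = s.reg r) ∧ (∀ a < N + N + L + L, s'.mem a = s.mem a) ∧
      ∀ t : Fin L, s'.mem (N + N + L + L + t) = if t < k then c' t else c t) ?_ ?_ ?_).le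
        (by omega) (by omega)).mono le_rfl le_rfl ?_
  · refine ⟨by simp, rfl, fun r hr => ?_, fun _ _ => rfl, fun j => by simp [hc]⟩
    simp [Function.update_of_ne (show r ≠ 23 by omega)]
  · rintro k x s' ⟨h1, -, h2, -⟩
    exact ⟨h1, by simp [Expr.val, h2 1 (by norm_num), h.reg1]⟩
  · rintro k hk c' s' ⟨h1, h2, h3, h4, h5⟩
    have hv : (distExpr (.mem (.add (.reg 15) (.reg 23)))
        (.mem (.add (.reg 16) (.reg 23)))).val s' =
        if y ⟨k, hk⟩ ≠ z ⟨k, hk⟩ then 1 else 0 := by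
      refine val_distExpr ?_ ?_
      · simp only [Expr.val, h3 15 (by norm_num), h.reg15, h1]
        rw [h4 _ (by omega)]
        exact hy ⟨k, hk⟩
      · simp only [Expr.val, h3 16 (by norm_num), h.reg16, h1]
        rw [h4 _ (by omega)]
        exact hz ⟨k, hk⟩
    refine Sim.store ⟨h1, by simp, h2, fun r hr => ?_, fun a ha => ?_, fun t => ?_⟩
    · simp [Function.update_of_ne (show r ≠ 23 by omega), h3 r hr]
    · simp only [Expr.val, h1, h3 17 (by norm_num), h.reg17]
      rw [Function.update_of_ne (by omega), h4 a ha]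
    · simp only [Expr.val, hv, h1, h3 17 (by norm_num), h.reg17]
      by_cases htk : t.val = k
      · have : t = ⟨k, hk⟩ := Fin.ext htk
        subst this
        rw [Function.update_self, h5 ⟨k, hk⟩]
        simp [h2]
      · rw [Function.update_of_ne (by omega), h5 t]
        have : t.val < k + 1 ↔ t.val < k := by omega
        simp only [this]
  · rintro c' s' ⟨-, -, h1, h2, h3⟩
    exact ⟨h1, fun a ha => h2 a (by omega), fun t => by rw [h3, if_pos t.2]⟩

/-- Increase the count of every output at which two random points differ. -/
def pairCmd : Cmd :=
  .seq sampleCmd (.seq (.query (.reg 0) (.reg 15)) (.seq sampleCmd (.seq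
    (.query (.reg 0) (.reg 16)) compareCmd)))

theorem sim_pairCmd (h : Layout L k₁ k₂ g s) {c : Fin L → ℕ}
    (hc : ∀ t : Fin L, s.mem (N + N + L + L + t) = c t) :
    Sim F pairCmd s ((Coin.pairSample F g).bind fun v => .ret fun t => c t + v t)
      (14 * N + 4 * L + 15) 2 fun c' s' => (∀ r < 23, s'.reg r = s.reg r) ∧
        (∀ a < N, s'.mem a = s.mem a) ∧ ∀ t : Fin L, s'.mem (N + N + L + L + t) = c' t := by
  rw [Coin.pairSample, Coin.bind_assoc]
  simp only [Coin.bind_assoc]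
  refine ((sim_sampleCmd h.reg0 h.holds).bind fun x s₁ ⟨r₁, m₁, x₁⟩ => ?_).le
    (t := 7 * N + 3 + (7 * N + 4 * L + 11) + 1) (q := 0 + 2) (by omega) (by omega)
  have l₁ := h.of_eq (fun r hr => r₁ r (by omega)) fun a ha => m₁ a (by omega)
  refine ((sim_query_reg l₁.reg0 l₁.reg15 x₁).bind_ret fun s₂ ⟨r₂, m₂, y₂⟩ => ?_).le
    (t := 1 + (7 * N + 4 * L + 9) + 1) (q := 1 + 1) (by omega) (by omega)
  have l₂ := l₁.of_eq (fun r _ => congrFun r₂ r) fun a ha => m₂ a (by omega)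
  refine ((sim_sampleCmd l₂.reg0 l₂.holds).bind fun y s₃ ⟨r₃, m₃, x₃⟩ => ?_).le
    (t := 7 * N + 3 + (4 * L + 5) + 1) (q := 0 + 1) (by omega) (by omega)
  have l₃ := l₂.of_eq (fun r hr => r₃ r (by omega)) fun a ha => m₃ a (by omega)
  refine ((sim_query_reg l₃.reg0 l₃.reg16 x₃).bind_ret fun s₄ ⟨r₄, m₄, z₄⟩ => ?_).le
    (t := 1 + (4 * L + 3) + 1) (q := 1 + 0) (by omega) (by omega)
  have l₄ := l₃.of_eq (fun r _ => congrFun r₄ r) fun a ha => m₄ a (by omega)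
  refine (sim_compareCmd l₄ (c := c) (y := F (g.patch x)) (z := F (g.patch y)) ?_ ?_ z₄).mono
    le_rfl le_rfl ?_
  · intro t
    rw [m₄ _ (by omega), m₃ _ (by omega), m₂ _ (by omega), m₁ _ (by omega), hc]
  · intro t
    rw [m₄ _ (by omega), m₃ _ (by omega), y₂]
  · rintro c' s' ⟨h1, h2, h3⟩
    refine ⟨fun r hr => ?_, fun a ha => ?_, h3⟩
    · rw [h1 r hr, r₄, r₃ r (by omega), r₂, r₁ r (by omega)]
    · rw [h2 a ha, m₄ a (by omega), m₃ a (by omega), m₂ a (by omega), m₁ a (by omega)]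

/-- Compare the value of the output in register `19` at the point in memory, which is in register
`26`, with its values at the points that differ from it in one unassigned coordinate, and increase
the counts of the coordinates for which there is a difference. -/
def negateCmd : Cmd :=
  forLoop 23 (.reg 0) (.ite (.mem (.reg 23)) .skip (
    .seq (.assign 27 (.mem (.add (.reg 0) (.reg 23)))) (
    .seq (.store (.add (.reg 0) (.reg 23)) (.sub (.const 1) (.reg 27))) (
    .seq (.query (.reg 0) (.reg 15)) (
    .seq (.store (.add (.reg 17) (.reg 23)) (.add (.mem (.add (.reg 17) (.reg 23)))
      (distExpr (.reg 26) (.mem (.add (.reg 15) (.reg 19))))))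
    (.store (.add (.reg 0) (.reg 23)) (.reg 27)))))))

theorem sim_negateCmd (h : Layout L k₁ k₂ g s) {c : Fin N → ℕ} {x : Fin N → Bool} {t : Fin L}
    (hc : ∀ i : Fin N, s.mem (N + N + L + L + i) = c i)
    (hx : ∀ j : Fin N, s.mem (N + j) = (g.patch x j).toNat) (ht : s.reg 19 = t)
    (hb : s.reg 26 = (F (g.patch x) t).toNat) :
    Sim F negateCmd s
      (.ret fun i => c i + if F (g.patch x) t ≠ F (g.patch (flipAt i x)) t then 1 else 0)
      (13 * N + 3) N fun c' s' => (∀ r < 23, s'.reg r = s.reg r) ∧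
        (∀ a < N, s'.mem a = s.mem a) ∧ ∀ i : Fin N, s'.mem (N + N + L + L + i) = c' i := by
  set v : Fin N → ℕ := fun i =>
    c i + if F (g.patch x) t ≠ F (g.patch (flipAt i x)) t then 1 else 0 with hv
  rw [← Coin.iter_ret v N]
  refine ((Sim.forLoop (n := N) (t := 10) (q := 1) (fun k c' s' => s'.reg 23 = k ∧ c' = v ∧
    (∀ r < 23, s'.reg r = s.reg r) ∧ s'.reg 26 = s.reg 26 ∧ (∀ a < N, s'.mem a = s.mem a) ∧
    (∀ j : Fin N, s'.mem (N + j) = (g.patch x j).toNat) ∧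
      ∀ i : Fin N, s'.mem (N + N + L + L + i) = if i < k then v i else c i) ?_ ?_ ?_).le
        (by omega) (by omega)).mono le_rfl le_rfl ?_
  · refine ⟨by simp, rfl, fun r hr => ?_, by simp, fun _ _ => rfl, hx, fun j => by simp [hc]⟩
    simp [Function.update_of_ne (show r ≠ 23 by omega)]
  · rintro k x s' ⟨h1, -, h2, -⟩
    exact ⟨h1, by simp [Expr.val, h2 0 (by norm_num), h.reg0]⟩
  · rintro k hk c' s' ⟨h1, h2, h3, h26, h4, h5, h6⟩
    have l := h.of_eq (fun r hr => h3 r (by omega)) h4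
    have hcell : s'.mem k = cell (g ⟨k, hk⟩) := l.holds ⟨k, hk⟩
    by_cases hgk : g ⟨k, hk⟩ = none
    · refine Sim.ite_neg (t := 9) (by simp [Expr.val, h1, hcell, hgk, cell]) ?_
      refine Sim.assign_seq (t := 7) (Sim.store_seq (t := 5) ?_)
      simp only [Expr.val, Function.update_self, l.reg0, h1,
        Function.update_of_ne (show (0 : ℕ) ≠ 27 by norm_num),
        Function.update_of_ne (show (23 : ℕ) ≠ 27 by norm_num)]
      refine ((sim_query_reg (a := N + N) (x := g.patch (flipAt ⟨k, hk⟩ x)) ?_ ?_ ?_).bind_ret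
        fun s₂ ⟨r₂, m₂, y₂⟩ => ?_).le (t := 1 + 3 + 1) (q := 1 + 0) (by omega) (by omega)
      · simp [l.reg0]
      · simp [l.reg15]
      · intro j
        change Function.update s'.mem (N + k) (1 - s'.mem (N + k)) (N + j) = _
        by_cases hjk : j.val = k
        · have : j = ⟨k, hk⟩ := Fin.ext hjk
          subst this
          rw [Function.update_self, h5 ⟨k, hk⟩]
          cases hxk : x ⟨k, hk⟩ <;> simp [PartialAssignment.patch, flipAt, hgk, hxk]
        · have hne : j ≠ ⟨k, hk⟩ := fun e => hjk (congrArg Fin.val e)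
          rw [Function.update_of_ne (by omega), h5 j]
          simp [PartialAssignment.patch, flipAt, hne]
      simp only at r₂ m₂
      have e : ∀ r, r ≠ 27 → s₂.reg r = s'.reg r := fun r hr => by
        rw [r₂, Function.update_of_ne hr]
      have hval : (distExpr (.reg 26) (.mem (.add (.reg 15) (.reg 19)))).val s₂ =
          if F (g.patch x) t ≠ F (g.patch (flipAt ⟨k, hk⟩ x)) t then 1 else 0 := by
        refine val_distExpr ?_ ?_
        · simp only [Expr.val, e 26 (by norm_num), h26, hb]
        · simp only [Expr.val, e 15 (by norm_num), e 19 (by norm_num), l.reg15,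
            h3 19 (by norm_num), ht, y₂]
      refine Sim.store_seq (t := 1) (Sim.store ?_)
      simp only [Expr.val, hval, e 17 (by norm_num), e 23 (by norm_num), e 0 (by norm_num), l.reg17,
        l.reg0, h1, show s₂.reg 27 = s'.mem (N + k) by rw [r₂, Function.update_self]]
      refine ⟨trivial, by simp, h2, fun r hr => ?_, ?_, fun a ha => ?_, fun j => ?_, fun i => ?_⟩
      · rw [Function.update_of_ne (by omega), e r (by omega), h3 r hr]
      · rw [Function.update_of_ne (by omega), e 26 (by omega), h26]
      · rw [Function.update_of_ne (by omega), Function.update_of_ne (by omega), m₂ a (by omega),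
          Function.update_of_ne (by omega), h4 a ha]
      · by_cases hjk : j.val = k
        · rw [← h5 j, hjk, Function.update_self]
        · rw [Function.update_of_ne (by omega), Function.update_of_ne (by omega),
            m₂ _ (by omega), Function.update_of_ne (by omega), h5 j]
      · rw [Function.update_of_ne (by omega)]
        by_cases hik : i.val = k
        · have : i = ⟨k, hk⟩ := Fin.ext hik
          subst this
          rw [Function.update_self, m₂ _ (by omega), Function.update_of_ne (by omega),
            h6 ⟨k, hk⟩]
          simp [hv]
        · rw [Function.update_of_ne (by omega), m₂ _ (by omega),
            Function.update_of_ne (by omega), h6 i]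
          have : i.val < k + 1 ↔ i.val < k := by omega
          simp only [this]
    · refine (Sim.ite_pos (t := 1) (q := 0) ?_ (Sim.skip ?_)).le (by omega) (by omega)
      · obtain ⟨b, hb⟩ := Option.ne_none_iff_exists'.1 hgk
        simp [Expr.val, h1, hcell, hb, cell]
      refine ⟨h1, by simp, h2, fun r hr => ?_, ?_, h4, h5, fun i => ?_⟩
      · simp [Function.update_of_ne (show r ≠ 23 by omega), h3 r hr]
      · simpa using h26
      · rw [h6 i]
        by_cases hik : i.val = k
        · have : i = ⟨k, hk⟩ := Fin.ext hik
          subst this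
          simp [hv, PartialAssignment.patch_flipAt_of_ne hgk]
        · have : i.val < k + 1 ↔ i.val < k := by omega
          simp only [this]
  · rintro c' s' ⟨-, rfl, h1, -, h2, -, h3⟩
    exact ⟨h1, h2, fun i => by rw [h3, if_pos i.2]⟩

/-- Increase the count of every coordinate to which the output in register `19` is sensitive at a
random point. -/
def sensitiveCmd : Cmd :=
  .seq sampleCmd (.seq (.query (.reg 0) (.reg 15))
    (.seq (.assign 26 (.mem (.add (.reg 15) (.reg 19)))) negateCmd))

theorem sim_sensitiveCmd (h : Layout L k₁ k₂ g s) {c : Fin N → ℕ} {t : Fin L}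
    (hc : ∀ i : Fin N, s.mem (N + N + L + L + i) = c i) (ht : s.reg 19 = t) :
    Sim F sensitiveCmd s ((Coin.flipSample F g t).bind fun v => .ret fun i => c i + v i)
      (20 * N + 11) (N + 1) fun c' s' => (∀ r < 23, s'.reg r = s.reg r) ∧
        (∀ a < N, s'.mem a = s.mem a) ∧ ∀ i : Fin N, s'.mem (N + N + L + L + i) = c' i := by
  rw [Coin.flipSample, Coin.bind_assoc]
  refine ((sim_sampleCmd h.reg0 h.holds).bind fun x s₁ ⟨r₁, m₁, x₁⟩ => ?_).le
    (t := 7 * N + 3 + (13 * N + 7) + 1) (q := 0 + (N + 1)) (by omega) (by omega)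
  have l₁ := h.of_eq (fun r hr => r₁ r (by omega)) fun a ha => m₁ a (by omega)
  refine ((sim_query_reg l₁.reg0 l₁.reg15 x₁).bind_ret fun s₂ ⟨r₂, m₂, y₂⟩ => ?_).le
    (t := 1 + (13 * N + 5) + 1) (q := 1 + N) (by omega) (by omega)
  have l₂ := l₁.of_eq (fun r _ => congrFun r₂ r) fun a ha => m₂ a (by omega)
  have ht₂ : s₂.reg 19 = t := by rw [r₂, r₁ 19 (by norm_num), ht]
  refine Sim.assign_seq ((sim_negateCmd (g := g) (k₁ := k₁) (k₂ := k₂) (c := c) (x := x) (t := t)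
    ?_ ?_ ?_ ?_ ?_).mono le_rfl le_rfl ?_)
  · exact l₂.of_eq (fun r hr => Function.update_of_ne (by omega) _ _) fun _ _ => rfl
  · intro i
    change s₂.mem _ = _
    rw [m₂ _ (by omega), m₁ _ (by omega), hc]
  · intro j
    change s₂.mem _ = _
    rw [m₂ _ (by omega), x₁]
  · simp [ht₂]
  · simp [Expr.val, ht₂, l₂.reg15, y₂]
  · rintro c' s' ⟨h1, h2, h3⟩
    refine ⟨fun r hr => ?_, fun a ha => ?_, h3⟩
    · rw [h1 r hr]
      simp [Function.update_of_ne (show r ≠ 26 by omega), r₂, r₁ r (show r < 30 by omega)]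
    · rw [h2 a ha, m₂ a (by omega), m₁ a (by omega)]

end OracleRAM

namespace OracleRAM

variable {N L : ℕ} {F : (Fin N → Bool) → (Fin L → Bool)} {k₁ k₂ : ℕ} {g : PartialAssignment N}
  {s : State}

/-- Sum up the output differences of as many pairs of points as register `11` says. -/
def tallyPairsCmd : Cmd := .seq (zeroCmd (.reg 1)) (forLoop 22 (.reg 11) pairCmd)

theorem sim_tallyPairsCmd (h : Layout L k₁ k₂ g s) :
    Sim F tallyPairsCmd s (Coin.tally (Coin.pairSample F g) k₁)
      (k₁ * (14 * N + 4 * L + 18) + 4 * L + 7) (k₁ * 2) fun c s' =>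
        (∀ r < 20, s'.reg r = s.reg r) ∧ (∀ a < N, s'.mem a = s.mem a) ∧
          ∀ t : Fin L, s'.mem (N + N + L + L + t) = c t := by
  refine ((sim_zeroCmd (by norm_num) h.reg1).bind_ret fun s₁ ⟨r₁, m₁, z₁⟩ => ?_).le
    (t := 4 * L + 3 + (k₁ * (14 * N + 4 * L + 18) + 3) + 1) (q := 0 + k₁ * 2) (by omega) (by omega)
  rw [h.reg17] at m₁ z₁
  refine ((Sim.forLoop (n := k₁) (t := 14 * N + 4 * L + 15) (q := 2) (fun k c s' =>
    s'.reg 22 = k ∧ (∀ r < 20, s'.reg r = s.reg r) ∧ (∀ a < N, s'.mem a = s.mem a) ∧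
      ∀ t : Fin L, s'.mem (N + N + L + L + t) = c t) ?_ ?_ ?_)).mono le_rfl le_rfl ?_
  · refine ⟨by simp, fun r hr => ?_, fun a ha => m₁ a (by omega), fun t => z₁ t t.2⟩
    simp [Function.update_of_ne (show r ≠ 22 by omega), r₁ r hr]
  · rintro k c s' ⟨h1, h2, -⟩
    exact ⟨h1, by simp [Expr.val, h2 11 (by norm_num), h.reg11]⟩
  · rintro k hk c s' ⟨h1, h2, h3, h4⟩
    refine (sim_pairCmd (h.of_eq (fun r hr => h2 r (by omega)) h3) h4).mono le_rfl le_rfl ?_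
    rintro c' s'' ⟨e1, e2, e3⟩
    refine ⟨(e1 22 (by norm_num)).trans h1, by simp, fun r hr => ?_, fun a ha => ?_, e3⟩
    · simp [Function.update_of_ne (show r ≠ 22 by omega), e1 r (show r < 23 by omega), h2 r hr]
    · exact (e2 a ha).trans (h3 a ha)
  · rintro c s' ⟨-, h⟩
    exact h

/-- Sum up the sensitive coordinates of as many points as register `10` says. -/
def tallyFlipsCmd : Cmd := .seq (zeroCmd (.reg 0)) (forLoop 22 (.reg 10) sensitiveCmd)

theorem sim_tallyFlipsCmd (h : Layout L k₁ k₂ g s) {t : Fin L} (ht : s.reg 19 = t) :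
    Sim F tallyFlipsCmd s (Coin.tally (Coin.flipSample F g t) k₂)
      (k₂ * (20 * N + 14) + 4 * N + 7) (k₂ * (N + 1)) fun c s' =>
        (∀ r < 20, s'.reg r = s.reg r) ∧ (∀ a < N, s'.mem a = s.mem a) ∧
          ∀ i : Fin N, s'.mem (N + N + L + L + i) = c i := by
  refine ((sim_zeroCmd (by norm_num) h.reg0).bind_ret fun s₁ ⟨r₁, m₁, z₁⟩ => ?_).le
    (t := 4 * N + 3 + (k₂ * (20 * N + 14) + 3) + 1) (q := 0 + k₂ * (N + 1)) (by omega) (by omega)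
  rw [h.reg17] at m₁ z₁
  refine ((Sim.forLoop (n := k₂) (t := 20 * N + 11) (q := N + 1) (fun k c s' =>
    s'.reg 22 = k ∧ (∀ r < 20, s'.reg r = s.reg r) ∧ (∀ a < N, s'.mem a = s.mem a) ∧
      ∀ i : Fin N, s'.mem (N + N + L + L + i) = c i) ?_ ?_ ?_)).mono le_rfl le_rfl ?_
  · refine ⟨by simp, fun r hr => ?_, fun a ha => m₁ a (by omega), fun t => z₁ t t.2⟩
    simp [Function.update_of_ne (show r ≠ 22 by omega), r₁ r hr]
  · rintro k c s' ⟨h1, h2, -⟩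
    exact ⟨h1, by simp [Expr.val, h2 10 (by norm_num), h.reg10]⟩
  · rintro k hk c s' ⟨h1, h2, h3, h4⟩
    refine (sim_sensitiveCmd (h.of_eq (fun r hr => h2 r (by omega)) h3) h4
      ((h2 19 (by norm_num)).trans ht)).mono le_rfl le_rfl ?_
    rintro c' s'' ⟨e1, e2, e3⟩
    refine ⟨(e1 22 (by norm_num)).trans h1, by simp, fun r hr => ?_, fun a ha => ?_, e3⟩
    · simp [Function.update_of_ne (show r ≠ 22 by omega), e1 r (show r < 23 by omega), h2 r hr]
    · exact (e2 a ha).trans (h3 a ha)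
  · rintro c s' ⟨-, h⟩
    exact h

/-- Assign a random bit to the coordinate in register `25`, if it is not assigned yet. -/
def fixCmd : Cmd :=
  .seq (.flip 28) (.ite (.mem (.reg 25)) .skip (.store (.reg 25) (.add (.const 1) (.reg 28))))

theorem sim_fixCmd (hg : Holds g s) {i : Fin N} (hi : s.reg 25 = i) :
    Sim F fixCmd s (.flip fun b => .ret (g.fix i b)) 4 0 fun g' s' =>
      (∀ r < 20, s'.reg r = s.reg r) ∧ Holds g' s' ∧ g'.dom.card ≤ g.dom.card + 1 := by
  refine Sim.flip_seq (t := 2) fun b ω => ?_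
  have hcell := hg i
  have hreg : ∀ r < 20, Function.update s.reg 28 b.toNat r = s.reg r := fun r hr =>
    Function.update_of_ne (by omega) _ _
  by_cases hgi : g i = none
  · refine Sim.ite_neg (by simp [Expr.val, hi, hcell, hgi, cell])
      (Sim.store ⟨hreg, fun j => ?_, g.card_dom_fix_le i b⟩)
    simp only [Expr.val, Function.update_self,
      Function.update_of_ne (show (25 : ℕ) ≠ 28 by norm_num), hi, PartialAssignment.fix, hgi,
      if_true]
    by_cases hj : j = i
    · subst hj; simp [cell]
    · rw [Function.update_of_ne (fun e => hj (Fin.ext e)), Function.update_of_ne hj]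
      exact hg j
  · refine Sim.ite_pos ?_ (Sim.skip ⟨hreg, ?_, g.card_dom_fix_le i b⟩)
    · obtain ⟨b', hb'⟩ := Option.ne_none_iff_exists'.1 hgi
      simp [Expr.val, hi, hcell, hb', cell]
    · rw [PartialAssignment.fix, if_neg hgi]
      exact hg

/-- One stage of the search. -/
def stageCmd : Cmd :=
  .seq tallyPairsCmd (.seq (argmaxCmd (.reg 1)) (.seq (.assign 19 (.reg 25))
    (.seq tallyFlipsCmd (.seq (argmaxCmd (.reg 0)) fixCmd))))

theorem sim_stageCmd (hN : 0 < N) (hL : 0 < L) (h : Layout L k₁ k₂ g s) :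
    Sim F stageCmd s (Coin.stage F hN hL k₁ k₂ g)
      (k₁ * (14 * N + 4 * L + 18) + k₂ * (20 * N + 14) + 9 * N + 9 * L + 34)
      (k₁ * 2 + k₂ * (N + 1)) fun g' s' => (∀ r < 19, s'.reg r = s.reg r) ∧
        Layout L k₁ k₂ g' s' ∧ g'.dom.card ≤ g.dom.card + 1 := by
  refine ((sim_tallyPairsCmd h).bind fun c s₁ ⟨r₁, m₁, c₁⟩ => ?_).le
    (t := k₁ * (14 * N + 4 * L + 18) + 4 * L + 7 + (k₂ * (20 * N + 14) + 9 * N + 5 * L + 26) + 1)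
    (q := k₁ * 2 + k₂ * (N + 1)) (by omega) (by omega)
  have l₁ := h.of_eq (fun r hr => r₁ r (by omega)) m₁
  refine ((sim_argmaxCmd (by norm_num) l₁.reg1 hL (c := c)
    (by rw [l₁.reg17]; exact c₁)).bind_ret fun s₂ ⟨r₂, m₂, a₂⟩ => ?_).le
    (t := 5 * L + 5 + (k₂ * (20 * N + 14) + 9 * N + 20) + 1)
    (q := 0 + k₂ * (N + 1)) (by omega) (by omega)
  have l₂ := l₁.of_eq (fun r hr => r₂ r (by omega)) fun a _ => congrFun m₂ a
  refine Sim.le (t := k₂ * (20 * N + 14) + 9 * N + 18 + 2) (Sim.assign_seq ?_) (by omega) le_rfl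
  simp only [Expr.val, a₂]
  have l₂' : Layout L k₁ k₂ g { s₂ with
      reg := Function.update s₂.reg 19 (argmaxFin hL c : ℕ) } :=
    l₂.of_eq (fun r hr => Function.update_of_ne (by omega) _ _) fun _ _ => rfl
  refine ((sim_tallyFlipsCmd l₂' (t := argmaxFin hL c) (by simp)).bind
    fun c' s₃ ⟨r₃, m₃, c₃⟩ => ?_).le
    (t := k₂ * (20 * N + 14) + 4 * N + 7 + (5 * N + 10) + 1)
    (q := k₂ * (N + 1) + 0) (by omega) (by omega)
  have l₃ := l₂'.of_eq (fun r hr => r₃ r (by omega)) m₃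
  refine ((sim_argmaxCmd (F := F) (by norm_num) l₃.reg0 hN (c := c')
    (by rw [l₃.reg17]; exact c₃)).bind_ret (t₂ := 4) (q₂ := 0) fun s₄ ⟨r₄, m₄, a₄⟩ => ?_).le
    (by omega) (by omega)
  have l₄ := l₃.of_eq (fun r hr => r₄ r (by omega)) fun a _ => congrFun m₄ a
  refine (sim_fixCmd l₄.holds a₄).mono le_rfl le_rfl ?_
  rintro g' s' ⟨r₅, h₅, d₅⟩
  refine ⟨fun r hr => ?_, ?_, d₅⟩
  · rw [r₅ r (by omega), r₄ r (by omega), r₃ r (by omega)]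
    change Function.update s₂.reg 19 _ r = _
    rw [Function.update_of_ne (by omega), r₂ r (by omega), r₁ r (by omega)]
  · obtain ⟨h0, h1, h2, h3, h4, h5, h6, -⟩ := l₄
    constructor <;> first | rwa [r₅ _ (by norm_num)] | exact h₅

/-! ### The program: parameters and the random number of stages -/

/-- `dst := e * b`, by repeated addition. -/
def mulCmd (dst : ℕ) (e b : Expr) : Cmd :=
  .seq (.assign dst (.const 0)) (forLoop 21 b (.assign dst (.add (.reg dst) e)))

theorem sim_mulCmd {dst a b : ℕ} (ha : a ≠ dst) (hb : b ≠ dst) (ha' : a ≠ 21) (hb' : b ≠ 21)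
    (hd : dst ≠ 21) {s : State} :
    Sim F (mulCmd dst (.reg a) (.reg b)) s (.ret ()) (4 * s.reg b + 5) 0 fun _ s' =>
      s'.mem = s.mem ∧ s'.reg dst = s.reg a * s.reg b ∧
        ∀ r, r ≠ dst → r ≠ 21 → s'.reg r = s.reg r := by
  rw [← Coin.iter_ret () (s.reg b)]
  refine (Sim.assign_seq (Sim.forLoop (n := s.reg b) (t := 1) (q := 0) (fun k _ s' =>
    s'.reg 21 = k ∧ s'.mem = s.mem ∧ s'.reg dst = s.reg a * k ∧
      ∀ r, r ≠ dst → r ≠ 21 → s'.reg r = s.reg r) ?_ ?_ ?_)).mono (by omega) (by omega) ?_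
  · refine ⟨by simp, rfl, by simp [hd, Expr.val], fun r h1 h2 => by simp [h1, h2]⟩
  · rintro k _ s' ⟨h1, -, -, h2⟩
    exact ⟨h1, h2 b hb hb'⟩
  · rintro k hk _ s' ⟨h1, h2, h3, h4⟩
    refine Sim.assign ⟨?_, by simp, h2, ?_, fun r hr hr' => by simp [hr, hr', h4 r hr hr']⟩
    · simp [hd.symm, h1]
    · simp [hd, Expr.val, h3, h4 a ha ha', mul_add]
  · rintro _ s' ⟨-, h⟩
    exact h

/-- `dst := ⌈den / num⌉`, by repeated addition. -/
def ceilCmd (dst num den : ℕ) : Cmd :=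
  .seq (.assign dst (.const 0)) (.seq (.assign 9 (.const 0))
    (.loop (.sub (.reg den) (.reg 9))
      (.seq (.assign 9 (.add (.reg 9) (.reg num))) (.assign dst (.add (.reg dst) (.const 1))))))

theorem sim_ceilCmd {dst num den : ℕ} (hd : dst ≠ 9) (h1 : num ≠ dst) (h2 : den ≠ dst)
    (h3 : num ≠ 9) (h4 : den ≠ 9) {s : State} {E : ℕ}
    (hE : ∀ k, k < E ↔ k * s.reg num < s.reg den) :
    Sim F (ceilCmd dst num den) s (.ret ()) (4 * E + 5) 0 fun _ s' =>
      s'.mem = s.mem ∧ s'.reg dst = E ∧ ∀ r, r ≠ dst → r ≠ 9 → s'.reg r = s.reg r := by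
  rw [← Coin.iter_ret () E]
  refine (Sim.assign_seq (Sim.assign_seq (Sim.loop (n := E) (t := 3) (q := 0) (fun k _ s' =>
    s'.reg dst = k ∧ s'.reg 9 = k * s.reg num ∧ s'.mem = s.mem ∧
      ∀ r, r ≠ dst → r ≠ 9 → s'.reg r = s.reg r) ?_ ?_ ?_ ?_))).mono (by omega) (by omega) ?_
  · refine ⟨by simp [hd, Expr.val], by simp [Expr.val], rfl, fun r h1 h2 => by simp [h1, h2]⟩
  · rintro k hk _ s' ⟨-, h5, -, h6⟩
    have := (hE k).1 hk
    simp only [Expr.val, h5, h6 den h2 h4]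
    omega
  · rintro _ s' ⟨-, h5, -, h6⟩
    have := (hE E).not.1 (lt_irrefl _)
    simp only [Expr.val, h5, h6 den h2 h4]
    omega
  · rintro k hk _ s' ⟨h5, h6, h7, h8⟩
    refine Sim.assign_seq (t := 1) (Sim.assign ⟨?_, ?_, h7, fun r hr hr' => ?_⟩)
    · simp [Expr.val, hd, h5]
    · simp [Expr.val, hd.symm, h6, h8 num h1 h3, add_mul]
    · simp [hr, hr', h8 r hr hr']
  · rintro _ s' ⟨h5, -, h6, h7⟩
    exact ⟨h6, h5, h7⟩

/-- Multiply a register by four. -/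
def quadCmd (r : ℕ) : Cmd := .assign r (.add (.add (.reg r) (.reg r)) (.add (.reg r) (.reg r)))

/-- Double register `13`, starting from `1`, until it is at least register `12`, and draw a random
number below it in register `14`. -/
def numberCmd : Cmd :=
  .seq (.assign 13 (.const 1)) (.seq (.assign 14 (.const 0))
    (.loop (.sub (.reg 12) (.reg 13)) (.seq (.flip 28)
      (.seq (.assign 14 (.add (.add (.reg 14) (.reg 14)) (.reg 28)))
        (.assign 13 (.add (.reg 13) (.reg 13)))))))

theorem sim_numberCmd {s : State} :
    Sim F numberCmd s (Coin.number (Nat.clog 2 (s.reg 12))) (6 * Nat.clog 2 (s.reg 12) + 5) 0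
      fun n s' => s'.mem = s.mem ∧ s'.reg 14 = n ∧ n < 2 ^ Nat.clog 2 (s.reg 12) ∧
        ∀ r < 18, r ≠ 13 → r ≠ 14 → s'.reg r = s.reg r := by
  refine (Sim.assign_seq (Sim.assign_seq (Sim.loop (n := Nat.clog 2 (s.reg 12)) (t := 5) (q := 0)
    (fun k n s' => s'.reg 13 = 2 ^ k ∧ s'.mem = s.mem ∧ s'.reg 14 = n ∧ n < 2 ^ k ∧
      ∀ r < 18, r ≠ 13 → r ≠ 14 → s'.reg r = s.reg r) ?_ ?_ ?_ ?_))).mono (by omega) (by omega) ?_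
  · refine ⟨by simp [Expr.val], rfl, by simp [Expr.val], by simp,
      fun r _ h13 h14 => by simp [h13, h14]⟩
  · rintro k hk _ s' ⟨h5, -, -, -, h6⟩
    have := Nat.pow_lt_of_lt_clog hk
    simp only [Expr.val, h5, h6 12 (by norm_num) (by norm_num) (by norm_num)]
    omega
  · rintro _ s' ⟨h5, -, -, -, h6⟩
    have := Nat.le_pow_clog (b := 2) (by norm_num) (s.reg 12)
    simp only [Expr.val, h5, h6 12 (by norm_num) (by norm_num) (by norm_num)]
    omega
  · rintro k hk n s' ⟨h5, h6, h7, h8, h9⟩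
    refine Sim.flip_seq (t := 3) fun b ω => Sim.assign_seq (t := 1) (Sim.assign
      ⟨?_, h6, ?_, ?_, fun r hr h13 h14 => ?_⟩)
    · simp [h5, pow_succ, Expr.val]; ring
    · simp [h7, Expr.val]
    · have := b.toNat_le
      rw [pow_succ]; omega
    · simp [h13, h14, Function.update_of_ne (show r ≠ 28 by omega), h9 r hr h13 h14]
  · rintro n s' ⟨-, h⟩
    exact h

/-- The search: a random number of stages. -/
def searchCmd : Cmd := .seq numberCmd (forLoop 18 (.reg 14) stageCmd)

theorem sim_searchCmd (hN : 0 < N) (hL : 0 < L)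
    (h : Layout L k₁ k₂ (fun _ => none : PartialAssignment N) s) {n : ℕ}
    (hn : Nat.clog 2 (s.reg 12) = n) :
    Sim F searchCmd s (Coin.search F hN hL k₁ k₂ n)
      (6 * n + 2 ^ n * (k₁ * (14 * N + 4 * L + 18) + k₂ * (20 * N + 14) + 9 * N + 9 * L + 37) + 9)
      (2 ^ n * (k₁ * 2 + k₂ * (N + 1))) fun g' s' => Holds g' s' ∧ g'.dom.card ≤ 2 ^ n := by
  set T := k₁ * (14 * N + 4 * L + 18) + k₂ * (20 * N + 14) + 9 * N + 9 * L + 34 with hT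
  have hnum := sim_numberCmd (F := F) (s := s)
  rw [hn] at hnum
  refine (hnum.bind fun j s₁ ⟨m₁, j₁, hj, r₁⟩ => ?_).le
    (t := 6 * n + 5 + (2 ^ n * (T + 3) + 3) + 1) (q := 0 + 2 ^ n * (k₁ * 2 + k₂ * (N + 1)))
    (by rw [show k₁ * (14 * N + 4 * L + 18) + k₂ * (20 * N + 14) + 9 * N + 9 * L + 37 = T + 3 by
      omega]; omega) (by omega)
  have l₁ : Layout L k₁ k₂ (fun _ => none : PartialAssignment N) s₁ := by
    obtain ⟨h0, h1, h2, h3, h4, h5, h6, h7⟩ := h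
    constructor <;>
      first | rwa [r₁ _ (by norm_num) (by norm_num) (by norm_num)] | exact fun j => by rw [m₁, h7 j]
  refine (Sim.forLoop (n := j) (t := T) (q := k₁ * 2 + k₂ * (N + 1)) (fun k g s' =>
    s'.reg 18 = k ∧ s'.reg 14 = j ∧ Layout L k₁ k₂ g s' ∧ g.dom.card ≤ k) ?_ ?_ ?_).mono
      (by gcongr) (by gcongr) ?_
  · refine ⟨by simp, by simp [j₁], l₁.of_eq (fun r hr => ?_) fun _ _ => rfl, by
      simp [PartialAssignment.dom]⟩
    simp [Function.update_of_ne (show r ≠ 18 by omega)]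
  · rintro k g s' ⟨h1, h2, -⟩
    exact ⟨h1, h2⟩
  · rintro k hk g s' ⟨h1, h2, h3, h4⟩
    refine (sim_stageCmd hN hL h3).mono le_rfl le_rfl ?_
    rintro g' s'' ⟨e1, e2, e3⟩
    refine ⟨(e1 18 (by norm_num)).trans h1, by simp, ?_, e2.of_eq (fun r hr => ?_) fun _ _ => rfl,
      by omega⟩
    · simp [e1 14 (by norm_num), h2]
    · simp [Function.update_of_ne (show r ≠ 18 by omega)]
  · rintro g' s' ⟨-, -, h1, h2⟩
    exact ⟨h1.holds, by omega⟩

end OracleRAM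

namespace OracleRAM

variable {N L : ℕ} {F : (Fin N → Bool) → (Fin L → Bool)} {g : PartialAssignment N} {s : State}

/-- Compute the numbers of samples, a lower bound for the range of the random number of stages, and
the addresses of the memory layout, from `N`, `L`, `q` and the rounded values of `1 / ε` and
`1 / δ` in registers `7` and `8`. -/
def paramsCmd : Cmd :=
  .seq (mulCmd 9 (.reg 2) (.reg 7)) (.seq (mulCmd 12 (.reg 9) (.reg 9))
    (.seq (mulCmd 10 (.reg 12) (.reg 9)) (.seq (quadCmd 10) (.seq (quadCmd 10) (.seq (quadCmd 10)
    (.seq (mulCmd 11 (.reg 10) (.reg 1)) (.seq (mulCmd 12 (.reg 9) (.reg 2))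
    (.seq (mulCmd 13 (.reg 12) (.reg 8)) (.seq (mulCmd 12 (.reg 13) (.reg 1)) (.seq (quadCmd 12)
    (.seq (.assign 15 (.add (.reg 0) (.reg 0))) (.seq (.assign 16 (.add (.reg 15) (.reg 1)))
      (.assign 17 (.add (.reg 16) (.reg 1)))))))))))))))

theorem sim_quadCmd {r : ℕ} : Sim F (quadCmd r) s (.ret ()) 1 0 fun _ s' =>
    s'.mem = s.mem ∧ s'.reg r = 4 * s.reg r ∧ ∀ r', r' ≠ r → s'.reg r' = s.reg r' :=
  Sim.assign ⟨rfl, by simp only [Expr.val, Function.update_self]; omega,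
    fun r' hr => by simp [hr]⟩

theorem sim_addCmd {r a b : ℕ} : Sim F (.assign r (.add (.reg a) (.reg b))) s (.ret ()) 1 0
    fun _ s' => s'.mem = s.mem ∧ s'.reg r = s.reg a + s.reg b ∧
      ∀ r', r' ≠ r → s'.reg r' = s.reg r' :=
  Sim.assign ⟨rfl, by simp [Expr.val], fun r' hr => by simp [hr]⟩

theorem sim_paramsCmd {q E D : ℕ} (h0 : s.reg 0 = N) (h1 : s.reg 1 = L) (h2 : s.reg 2 = q)
    (h7 : s.reg 7 = E) (h8 : s.reg 8 = D) (hm : s.mem = fun _ => 0) :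
    Sim F paramsCmd s (.ret ()) (4 * E + 8 * (q * E) + 8 * L + 4 * q + 4 * D + 57) 0 fun _ s' =>
      Layout L (L * (64 * (q * E) ^ 3)) (64 * (q * E) ^ 3)
        (fun _ => none : PartialAssignment N) s' ∧
        s'.reg 12 = 4 * (L * q ^ 2 * E * D) := by
  -- The name `hᵢ_r` stands for the value of register `r` after the `i`-th command.
  refine ((sim_mulCmd (F := F) (s := s) (dst := 9) (a := 2) (b := 7) (by decide)
    (by decide) (by decide) (by decide) (by decide)).bind_ret
    (t₂ := 4 * (q * E) + 4 * (q * E) + 4 * L + 4 * q + 4 * D + 4 * L + 49) (q₂ := 0)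
    fun s₁ ⟨m₁, v₁, r₁⟩ => ?_).le
    (by rw [h7]; omega) (by omega)
  have h₁_0 := (r₁ 0 (by decide) (by decide)).trans h0
  have h₁_1 := (r₁ 1 (by decide) (by decide)).trans h1
  have h₁_2 := (r₁ 2 (by decide) (by decide)).trans h2
  have h₁_8 := (r₁ 8 (by decide) (by decide)).trans h8
  rw [h2, h7] at v₁
  refine ((sim_mulCmd (F := F) (s := s₁) (dst := 12) (a := 9) (b := 9) (by decide)
    (by decide) (by decide) (by decide) (by decide)).bind_ret
    (t₂ := 4 * (q * E) + 4 * L + 4 * q + 4 * D + 4 * L + 43) (q₂ := 0) fun s₂ ⟨m₂, v₂, r₂⟩ => ?_).le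
    (by rw [v₁]; omega) (by omega)
  have h₂_0 := (r₂ 0 (by decide) (by decide)).trans h₁_0
  have h₂_1 := (r₂ 1 (by decide) (by decide)).trans h₁_1
  have h₂_2 := (r₂ 2 (by decide) (by decide)).trans h₁_2
  have h₂_8 := (r₂ 8 (by decide) (by decide)).trans h₁_8
  have h₂_9 := (r₂ 9 (by decide) (by decide)).trans v₁
  rw [v₁] at v₂
  refine ((sim_mulCmd (F := F) (s := s₂) (dst := 10) (a := 12) (b := 9) (by decide)
    (by decide) (by decide) (by decide) (by decide)).bind_ret
    (t₂ := 4 * L + 4 * q + 4 * D + 4 * L + 37) (q₂ := 0) fun s₃ ⟨m₃, v₃, r₃⟩ => ?_).le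
    (by rw [h₂_9]; omega) (by omega)
  have h₃_0 := (r₃ 0 (by decide) (by decide)).trans h₂_0
  have h₃_1 := (r₃ 1 (by decide) (by decide)).trans h₂_1
  have h₃_2 := (r₃ 2 (by decide) (by decide)).trans h₂_2
  have h₃_8 := (r₃ 8 (by decide) (by decide)).trans h₂_8
  have h₃_9 := (r₃ 9 (by decide) (by decide)).trans h₂_9
  rw [v₂, h₂_9] at v₃
  refine ((sim_quadCmd (F := F) (s := s₃) (r := 10)).bind_ret
    (t₂ := 4 * L + 4 * q + 4 * D + 4 * L + 35) (q₂ := 0) fun s₄ ⟨m₄, v₄, r₄⟩ => ?_).le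
    (by omega) (by omega)
  have h₄_0 := (r₄ 0 (by decide)).trans h₃_0
  have h₄_1 := (r₄ 1 (by decide)).trans h₃_1
  have h₄_2 := (r₄ 2 (by decide)).trans h₃_2
  have h₄_8 := (r₄ 8 (by decide)).trans h₃_8
  have h₄_9 := (r₄ 9 (by decide)).trans h₃_9
  rw [v₃] at v₄
  refine ((sim_quadCmd (F := F) (s := s₄) (r := 10)).bind_ret
    (t₂ := 4 * L + 4 * q + 4 * D + 4 * L + 33) (q₂ := 0) fun s₅ ⟨m₅, v₅, r₅⟩ => ?_).le
    (by omega) (by omega)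
  have h₅_0 := (r₅ 0 (by decide)).trans h₄_0
  have h₅_1 := (r₅ 1 (by decide)).trans h₄_1
  have h₅_2 := (r₅ 2 (by decide)).trans h₄_2
  have h₅_8 := (r₅ 8 (by decide)).trans h₄_8
  have h₅_9 := (r₅ 9 (by decide)).trans h₄_9
  rw [v₄] at v₅
  refine ((sim_quadCmd (F := F) (s := s₅) (r := 10)).bind_ret
    (t₂ := 4 * L + 4 * q + 4 * D + 4 * L + 31) (q₂ := 0) fun s₆ ⟨m₆, v₆, r₆⟩ => ?_).le
    (by omega) (by omega)
  have h₆_0 := (r₆ 0 (by decide)).trans h₅_0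
  have h₆_1 := (r₆ 1 (by decide)).trans h₅_1
  have h₆_2 := (r₆ 2 (by decide)).trans h₅_2
  have h₆_8 := (r₆ 8 (by decide)).trans h₅_8
  have h₆_9 := (r₆ 9 (by decide)).trans h₅_9
  rw [v₅] at v₆
  refine ((sim_mulCmd (F := F) (s := s₆) (dst := 11) (a := 10) (b := 1) (by decide)
    (by decide) (by decide) (by decide) (by decide)).bind_ret
    (t₂ := 4 * q + 4 * D + 4 * L + 25) (q₂ := 0) fun s₇ ⟨m₇, v₇, r₇⟩ => ?_).le
    (by rw [h₆_1]; omega) (by omega)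
  have h₇_0 := (r₇ 0 (by decide) (by decide)).trans h₆_0
  have h₇_1 := (r₇ 1 (by decide) (by decide)).trans h₆_1
  have h₇_2 := (r₇ 2 (by decide) (by decide)).trans h₆_2
  have h₇_8 := (r₇ 8 (by decide) (by decide)).trans h₆_8
  have h₇_9 := (r₇ 9 (by decide) (by decide)).trans h₆_9
  have h₇_10 := (r₇ 10 (by decide) (by decide)).trans v₆
  rw [v₆, h₆_1] at v₇
  refine ((sim_mulCmd (F := F) (s := s₇) (dst := 12) (a := 9) (b := 2) (by decide)
    (by decide) (by decide) (by decide) (by decide)).bind_ret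
    (t₂ := 4 * D + 4 * L + 19) (q₂ := 0) fun s₈ ⟨m₈, v₈, r₈⟩ => ?_).le
    (by rw [h₇_2]; omega) (by omega)
  have h₈_0 := (r₈ 0 (by decide) (by decide)).trans h₇_0
  have h₈_1 := (r₈ 1 (by decide) (by decide)).trans h₇_1
  have h₈_8 := (r₈ 8 (by decide) (by decide)).trans h₇_8
  have h₈_10 := (r₈ 10 (by decide) (by decide)).trans h₇_10
  have h₈_11 := (r₈ 11 (by decide) (by decide)).trans v₇
  rw [h₇_9, h₇_2] at v₈
  refine ((sim_mulCmd (F := F) (s := s₈) (dst := 13) (a := 12) (b := 8) (by decide)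
    (by decide) (by decide) (by decide) (by decide)).bind_ret
    (t₂ := 4 * L + 13) (q₂ := 0) fun s₉ ⟨m₉, v₉, r₉⟩ => ?_).le
    (by rw [h₈_8]; omega) (by omega)
  have h₉_0 := (r₉ 0 (by decide) (by decide)).trans h₈_0
  have h₉_1 := (r₉ 1 (by decide) (by decide)).trans h₈_1
  have h₉_10 := (r₉ 10 (by decide) (by decide)).trans h₈_10
  have h₉_11 := (r₉ 11 (by decide) (by decide)).trans h₈_11
  rw [v₈, h₈_8] at v₉
  refine ((sim_mulCmd (F := F) (s := s₉) (dst := 12) (a := 13) (b := 1) (by decide)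
    (by decide) (by decide) (by decide) (by decide)).bind_ret
    (t₂ := 7) (q₂ := 0) fun sa ⟨ma, va, ra⟩ => ?_).le
    (by rw [h₉_1]) (by omega)
  have ha_0 := (ra 0 (by decide) (by decide)).trans h₉_0
  have ha_1 := (ra 1 (by decide) (by decide)).trans h₉_1
  have ha_10 := (ra 10 (by decide) (by decide)).trans h₉_10
  have ha_11 := (ra 11 (by decide) (by decide)).trans h₉_11
  rw [v₉, h₉_1] at va
  refine ((sim_quadCmd (F := F) (s := sa) (r := 12)).bind_ret
    (t₂ := 5) (q₂ := 0) fun sb ⟨mb, vb, rb⟩ => ?_).le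
    (by omega) (by omega)
  have hb_0 := (rb 0 (by decide)).trans ha_0
  have hb_1 := (rb 1 (by decide)).trans ha_1
  have hb_10 := (rb 10 (by decide)).trans ha_10
  have hb_11 := (rb 11 (by decide)).trans ha_11
  rw [va] at vb
  refine ((sim_addCmd (F := F) (s := sb) (r := 15) (a := 0) (b := 0)).bind_ret
    (t₂ := 3) (q₂ := 0) fun sc ⟨mc, vc, rc⟩ => ?_).le
    (by omega) (by omega)
  have hc_0 := (rc 0 (by decide)).trans hb_0
  have hc_1 := (rc 1 (by decide)).trans hb_1
  have hc_10 := (rc 10 (by decide)).trans hb_10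
  have hc_11 := (rc 11 (by decide)).trans hb_11
  have hc_12 := (rc 12 (by decide)).trans vb
  rw [hb_0] at vc
  refine ((sim_addCmd (F := F) (s := sc) (r := 16) (a := 15) (b := 1)).bind_ret
    (t₂ := 1) (q₂ := 0) fun sd ⟨md, vd, rd⟩ => ?_).le
    (by omega) (by omega)
  have hd_0 := (rd 0 (by decide)).trans hc_0
  have hd_1 := (rd 1 (by decide)).trans hc_1
  have hd_10 := (rd 10 (by decide)).trans hc_10
  have hd_11 := (rd 11 (by decide)).trans hc_11
  have hd_12 := (rd 12 (by decide)).trans hc_12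
  have hd_15 := (rd 15 (by decide)).trans vc
  rw [vc, hc_1] at vd
  refine (sim_addCmd (F := F) (s := sd) (r := 17) (a := 16) (b := 1)).mono le_rfl le_rfl ?_
  rintro _ s' ⟨m', v', r'⟩
  rw [vd, hd_1] at v'
  refine ⟨⟨(r' 0 (by decide)).trans hd_0, (r' 1 (by decide)).trans hd_1, ?_, ?_,
    (r' 15 (by decide)).trans hd_15, (r' 16 (by decide)).trans vd, v', fun j => ?_⟩, ?_⟩
  · rw [(r' 10 (by decide)).trans hd_10]; ring
  · rw [(r' 11 (by decide)).trans hd_11]; ring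
  · rw [m', md, mc, mb, ma, m₉, m₈, m₇, m₆, m₅, m₄, m₃, m₂, m₁, hm]; rfl
  · rw [(r' 12 (by decide)).trans hd_12]; ring

end OracleRAM

namespace OracleRAM

variable {N L : ℕ} {F : (Fin N → Bool) → (Fin L → Bool)} {s : State}

/-- Assign `0` to every coordinate. -/
def fillCmd : Cmd := forLoop 18 (.reg 0) (.store (.reg 18) (.const 1))

theorem sim_fillCmd (h0 : s.reg 0 = N) :
    Sim F fillCmd s (.ret ()) (4 * N + 3) 0 fun _ s' =>
      Holds (fun _ => some false : PartialAssignment N) s' := by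
  rw [← Coin.iter_ret () N]
  refine ((Sim.forLoop (n := N) (t := 1) (q := 0) (fun k _ s' => s'.reg 18 = k ∧
    s'.reg 0 = N ∧ ∀ j < k, s'.mem j = 1) ?_ ?_ ?_).le
      (by omega) (by omega)).mono le_rfl le_rfl ?_
  · exact ⟨by simp, by simp [h0], fun j hj => by omega⟩
  · rintro k _ s' ⟨h1, h2, -⟩
    exact ⟨h1, h2⟩
  · rintro k hk _ s' ⟨h1, h2, h3⟩
    refine Sim.store ⟨h1, by simp, by simp [h2], fun j hj => ?_⟩
    simp only [Expr.val, h1]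
    by_cases hjk : j = k
    · simp [hjk]
    · rw [Function.update_of_ne hjk, h3 j (by omega)]
  · rintro _ s' ⟨-, -, h⟩ j
    exact h j j.2

/-- The whole program. It leaves every coordinate unassigned if `q = 0`, `L = 0`, `ε ≥ 1` or
`δ ≥ 1`, assigns every coordinate if `N ≤ L`, and otherwise starts the search. -/
def mainCmd : Cmd :=
  .seq (ceilCmd 7 3 4) (.seq (ceilCmd 8 5 6)
    (.ite (.reg 2) (.ite (.reg 1) (.ite (.sub (.reg 7) (.const 1)) (.ite (.sub (.reg 8) (.const 1))
      (.ite (.sub (.reg 0) (.reg 1)) (.seq paramsCmd searchCmd) fillCmd)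
      .skip) .skip) .skip) .skip))

/-- The three kinds of runs of the program, in terms of `E = ⌈1 / ε⌉` and `D = ⌈1 / δ⌉`. -/
theorem sim_mainCmd {q E D : ℕ} (h0 : s.reg 0 = N) (h1 : s.reg 1 = L) (h2 : s.reg 2 = q)
    (hE : ∀ k, k < E ↔ k * s.reg 3 < s.reg 4) (hD : ∀ k, k < D ↔ k * s.reg 5 < s.reg 6)
    (hm : s.mem = fun _ => 0) :
    ((q = 0 ∨ L = 0 ∨ E ≤ 1 ∨ D ≤ 1) → Sim F mainCmd s (.ret ()) (4 * E + 4 * D + 17) 0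
      fun _ s' => Holds (fun _ => none : PartialAssignment N) s') ∧
    (0 < q → 0 < L → 1 < E → 1 < D → N ≤ L →
      Sim F mainCmd s (.ret ()) (4 * E + 4 * D + 4 * N + 20) 0
        fun _ s' => Holds (fun _ => some false : PartialAssignment N) s') ∧
    (∀ (hN : 0 < N) (hL : 0 < L), 0 < q → 1 < E → 1 < D → L < N →
      ∀ n, n = Nat.clog 2 (4 * (L * q ^ 2 * E * D)) →
      Sim F mainCmd s (Coin.search F hN hL (L * (64 * (q * E) ^ 3)) (64 * (q * E) ^ 3) n)
        (8 * E + 8 * D + 8 * (q * E) + 8 * L + 4 * q + 84 + 6 * n + 2 ^ n *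
          (L * (64 * (q * E) ^ 3) * (14 * N + 4 * L + 18) + 64 * (q * E) ^ 3 * (20 * N + 14) +
            9 * N + 9 * L + 37))
        (2 ^ n * (L * (64 * (q * E) ^ 3) * 2 + 64 * (q * E) ^ 3 * (N + 1)))
        fun g' s' => Holds g' s' ∧ g'.dom.card ≤ 2 ^ n) := by
  -- After the computation of `E` and `D` only the case distinction is left.
  have pre : ∀ {α : Type} {c : Cmd} {m : Coin α} {t qb : ℕ} {Q : α → State → Prop},
      (∀ s' : State, s'.mem = s.mem → s'.reg 0 = N → s'.reg 1 = L → s'.reg 2 = q → s'.reg 7 = E →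
        s'.reg 8 = D → Sim F c s' m t qb Q) →
      Sim F (.seq (ceilCmd 7 3 4) (.seq (ceilCmd 8 5 6) c)) s m (4 * E + 4 * D + 12 + t) qb Q := by
    intro α c m t qb Q h
    refine ((sim_ceilCmd (F := F) (s := s) (dst := 7) (num := 3) (den := 4) (E := E) (by decide)
      (by decide) (by decide) (by decide) (by decide) hE).bind_ret (t₂ := 4 * D + 6 + t) (q₂ := qb)
      fun s₁ ⟨m₁, v₁, r₁⟩ => ?_).le (by omega) (by omega)
    refine ((sim_ceilCmd (F := F) (s := s₁) (dst := 8) (num := 5) (den := 6) (E := D) (by decide)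
      (by decide) (by decide) (by decide) (by decide) ?_).bind_ret (t₂ := t) (q₂ := qb)
      fun s₂ ⟨m₂, v₂, r₂⟩ => ?_).le (by omega) (by omega)
    · rw [r₁ 5 (by decide) (by decide), r₁ 6 (by decide) (by decide)]
      exact hD
    · refine h s₂ (m₂.trans m₁) ?_ ?_ ?_ ?_ v₂
      · rw [r₂ 0 (by decide) (by decide), r₁ 0 (by decide) (by decide), h0]
      · rw [r₂ 1 (by decide) (by decide), r₁ 1 (by decide) (by decide), h1]
      · rw [r₂ 2 (by decide) (by decide), r₁ 2 (by decide) (by decide), h2]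
      · rw [r₂ 7 (by decide) (by decide), v₁]
  refine ⟨fun h => ?_, fun hq hL hE1 hD1 hNL => ?_, fun hN hL hq hE1 hD1 hLN n hn => ?_⟩
  · refine (pre (t := 5) fun s' em e0 e1 e2 e7 e8 => ?_).le (by omega) le_rfl
    have hs : Holds (fun _ => none : PartialAssignment N) s' := fun j => by rw [em, hm]; rfl
    by_cases hq : q = 0
    · exact (Sim.ite_neg (by simp [Expr.val, e2, hq]) (Sim.skip hs)).le (by omega) le_rfl
    refine Sim.ite_pos (t := 4) (by simp [Expr.val, e2, hq]) ?_
    by_cases hL : L = 0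
    · exact (Sim.ite_neg (by simp [Expr.val, e1, hL]) (Sim.skip hs)).le (by omega) le_rfl
    refine Sim.ite_pos (t := 3) (by simp [Expr.val, e1, hL]) ?_
    by_cases hE1 : E ≤ 1
    · exact (Sim.ite_neg (by simp only [Expr.val, e7]; omega) (Sim.skip hs)).le (by omega) le_rfl
    refine Sim.ite_pos (t := 2) (by simp only [Expr.val, e7]; omega) ?_
    exact Sim.ite_neg (by simp only [Expr.val, e8]; omega) (Sim.skip hs)
  · refine (pre (t := 4 * N + 3 + 1 + 1 + 1 + 1 + 1) fun s' em e0 e1 e2 e7 e8 =>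
      Sim.ite_pos ?_ (Sim.ite_pos ?_ (Sim.ite_pos ?_ (Sim.ite_pos ?_ (Sim.ite_neg ?_
        (sim_fillCmd e0)))))).le (by omega) le_rfl <;> simp only [Expr.val, e0, e1, e2, e7, e8] <;>
      omega
  · refine (pre fun s' em e0 e1 e2 e7 e8 => Sim.ite_pos ?_ (Sim.ite_pos ?_ (Sim.ite_pos ?_
      (Sim.ite_pos ?_ (Sim.ite_pos ?_ ((sim_paramsCmd (N := N) e0 e1 e2 e7 e8
        (em.trans hm)).bind_ret fun s₁ ⟨l₁, v₁⟩ =>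
          sim_searchCmd hN hL l₁ (by rw [v₁, hn]))))))).le ?_ ?_
    · simp only [Expr.val, e2]; omega
    · simp only [Expr.val, e1]; omega
    · simp only [Expr.val, e7]; omega
    · simp only [Expr.val, e8]; omega
    · simp only [Expr.val, e0, e1]; omega
    · omega
    · omega

end OracleRAM

/-! ### Accuracy and resources -/

section Final

open OracleRAM

variable {N L : ℕ} {F : (Fin N → Bool) → (Fin L → Bool)}

theorem card_dom_none : (PartialAssignment.dom fun _ : Fin N => none).card = 0 := by
  simp [PartialAssignment.dom]

theorem card_dom_le (g : PartialAssignment N) : g.dom.card ≤ N := by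
  simpa using Finset.card_le_univ g.dom

theorem smallVariance_of_one_le {ε : ℝ} (h : 1 ≤ ε) (g : PartialAssignment N) :
    SmallVariance F ε g :=
  (smallVariance_iff ε g).2 fun _ => (cubeDis_le_one _ _).trans h

theorem smallVariance_of_total {ε : ℝ} (h : 0 ≤ ε) (b : Bool) :
    SmallVariance F ε (fun _ => some b) := by
  refine (smallVariance_iff ε _).2 fun t => ?_
  have e : ∀ x : Fin N → Bool, PartialAssignment.patch (fun _ => some b) x = fun _ => b :=
    fun _ => rfl
  simpa [e, cubeDis, neInd_self, cubeAvg_const] using h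

theorem smallVariance_of_zero (hF : ∀ t, DTree.Computes 0 fun x => F x t) {ε : ℝ} (h : 0 ≤ ε)
    (g : PartialAssignment N) : SmallVariance F ε g := by
  refine (smallVariance_iff ε _).2 fun t => ?_
  obtain ⟨c, hc⟩ := (hF t).const
  simpa [cubeDis, hc, neInd_self, cubeAvg_const] using h

open Classical in
/-- From a run of the program to its resources and its probability of success. -/
theorem mainCmd_spec {q : ℕ} {ε δ : ℚ} {α : Type} {m : Coin α} {T qb B : ℕ}
    (out : α → PartialAssignment N)
    (h : ∀ ω, Sim F mainCmd (init N L q ε δ ω) m T qb fun a s' =>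
      Holds (out a) s' ∧ (out a).dom.card ≤ B) {C : ℝ} (hB : (B : ℝ) ≤ C)
    (hm : 1 - (δ : ℝ) ≤ m.ex fun a => if SmallVariance F ε (out a) then 1 else 0) :
    (∀ ω : ℕ → Bool, (run mainCmd F q ε δ ω T).1 = [] ∧
      (run mainCmd F q ε δ ω T).2.queries ≤ qb) ∧
    ENNReal.ofReal (1 - δ) ≤ coinMeasure {ω : ℕ → Bool |
      SmallVariance F ε (output N (run mainCmd F q ε δ ω T).2) ∧
      ((output N (run mainCmd F q ε δ ω T).2).dom.card : ℝ) ≤ C} := by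
  have hr := fun ω => (h ω).run_eq
  refine ⟨fun ω => ⟨(hr ω).1, (hr ω).2.1⟩, ?_⟩
  refine (ENNReal.ofReal_le_ofReal hm).trans ?_
  rw [← Coin.coinMeasure_run m fun a => SmallVariance F ε (out a)]
  refine MeasureTheory.measure_mono fun ω hω => ?_
  obtain ⟨-, -, h1, h2⟩ := hr ω
  simp only [Set.mem_ofPred_eq, h1.output_eq]
  exact ⟨hω, (Nat.cast_le.2 h2).trans hB⟩

/-- The test that stops the repeated addition in `OracleRAM.ceilCmd`. -/
theorem lt_ceil_iff {r : ℚ} (hr : 0 < r) (k : ℕ) :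
    k < ⌈1 / r⌉₊ ↔ k * r.num.toNat < r.den := by
  have hnum : 0 < r.num := Rat.num_pos.2 hr
  have hden : (0 : ℚ) < r.den := by exact_mod_cast r.den_pos
  have h1 : ((r.num.toNat : ℕ) : ℚ) = r * r.den := by
    have : ((r.num.toNat : ℕ) : ℤ) = r.num := Int.toNat_of_nonneg hnum.le
    rw [Rat.mul_den_eq_num, ← Int.cast_natCast, this]
  rw [Nat.lt_ceil, lt_div_iff₀ hr, ← Nat.cast_lt (α := ℚ), Nat.cast_mul, h1, ← mul_assoc]
  constructor
  · intro h
    nlinarith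
  · intro h
    by_contra! hcon
    nlinarith

/-- Each of the parameters is at most `X`, so the running time is at most a multiple of the `5`-th
power for the number of stages times the `8`-th power for the length of a stage. -/
theorem time_bound {N L q E D n X : ℕ} (hn : 2 ^ n ≤ 2 * (4 * (L * q ^ 2 * E * D)))
    (hX : X = N + L + q + E + D + 1) :
    8 * E + 8 * D + 8 * (q * E) + 8 * L + 4 * q + 84 + 6 * n + 2 ^ n *
      (L * (64 * (q * E) ^ 3) * (14 * N + 4 * L + 18) + 64 * (q * E) ^ 3 * (20 * N + 14) +
        9 * N + 9 * L + 37) ≤ 37000 * X ^ 13 := by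
  have hX1 : 1 ≤ X := by omega
  have hL : L ≤ X := by omega
  have hq : q ≤ X := by omega
  have hE : E ≤ X := by omega
  have hD : D ≤ X := by omega
  have hn' : n < 2 ^ n := Nat.lt_two_pow_self
  have h2n : 2 ^ n ≤ 8 * X ^ 5 := by
    calc 2 ^ n ≤ 2 * (4 * (L * q ^ 2 * E * D)) := hn
      _ ≤ 2 * (4 * (X * X ^ 2 * X * X)) := by gcongr
      _ = 8 * X ^ 5 := by ring
  have hu : q * E ≤ X ^ 2 := by
    calc q * E ≤ X * X := Nat.mul_le_mul hq hE
      _ = X ^ 2 := by ring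
  have hk2 : 64 * (q * E) ^ 3 ≤ 64 * X ^ 6 := by
    calc 64 * (q * E) ^ 3 ≤ 64 * (X ^ 2) ^ 3 := by gcongr
      _ = 64 * X ^ 6 := by ring
  have hp : ∀ j, j ≤ 13 → X ^ j ≤ X ^ 13 := fun j hj => Nat.pow_le_pow_right hX1 hj
  have hX8 : X ≤ X ^ 8 := by simpa using Nat.pow_le_pow_right hX1 (show 1 ≤ 8 by norm_num)
  have hX78 : X ^ 7 ≤ X ^ 8 := Nat.pow_le_pow_right hX1 (by norm_num)
  have hstage : L * (64 * (q * E) ^ 3) * (14 * N + 4 * L + 18) + 64 * (q * E) ^ 3 * (20 * N + 14) +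
      9 * N + 9 * L + 37 ≤ 4535 * X ^ 8 := by
    calc _ ≤ X * (64 * X ^ 6) * (36 * X) + 64 * X ^ 6 * (34 * X) + 55 * X := by
          have e1 : 14 * N + 4 * L + 18 ≤ 36 * X := by omega
          have e2 : 20 * N + 14 ≤ 34 * X := by omega
          have a1 := Nat.mul_le_mul (Nat.mul_le_mul hL hk2) e1
          have a2 := Nat.mul_le_mul hk2 e2
          omega
      _ = 2304 * X ^ 8 + 2176 * X ^ 7 + 55 * X := by ring
      _ ≤ 4535 * X ^ 8 := by omega
  have hmain := Nat.mul_le_mul h2n hstage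
  have e : 8 * X ^ 5 * (4535 * X ^ 8) = 36280 * X ^ 13 := by ring
  have p0 := hp 0 (by norm_num)
  have p1 := hp 1 (by norm_num)
  have p2 := hp 2 (by norm_num)
  have p5 := hp 5 (by norm_num)
  rw [pow_zero] at p0
  rw [pow_one] at p1
  omega

/-- The factor `L` comes from the number of stages and the factor `N` from the queries of one stage,
where `L ≤ N` absorbs the queries for the variances. -/
theorem query_bound {N L q E D n : ℕ} (hL : 0 < L) (hD : 0 < D) (hLN : L ≤ N)
    (hn : 2 ^ n ≤ 2 * (4 * (L * q ^ 2 * E * D))) :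
    2 ^ n * (L * (64 * (q * E) ^ 3) * 2 + 64 * (q * E) ^ 3 * (N + 1)) ≤
      L * N * (2048 * (q * E * D) ^ 5) := by
  have h1 : L * (64 * (q * E) ^ 3) * 2 + 64 * (q * E) ^ 3 * (N + 1) ≤
      N * (256 * (q * E) ^ 3) := by
    have a1 : L * (64 * (q * E) ^ 3) ≤ N * (64 * (q * E) ^ 3) := Nat.mul_le_mul_right _ hLN
    have a2 : 64 * (q * E) ^ 3 * (N + 1) ≤ 64 * (q * E) ^ 3 * (2 * N) :=
      Nat.mul_le_mul_left _ (by omega)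
    nlinarith
  rcases Nat.eq_zero_or_pos E with rfl | hE
  · simp
  calc _ ≤ 2 * (4 * (L * q ^ 2 * E * D)) * (N * (256 * (q * E) ^ 3)) := Nat.mul_le_mul hn h1
    _ = L * N * (2048 * (q ^ 5 * (E ^ 4 * D ^ 1))) := by ring
    _ ≤ L * N * (2048 * (q ^ 5 * (E ^ 5 * D ^ 5))) := by
        gcongr <;> omega
    _ = _ := by ring

end Final

theorem mainTheorem2 :
    (∀ (N L q : ℕ) (F : (Fin N → Bool) → (Fin L → Bool)),
      (∀ t : Fin L, DTree.Computes q (fun x => F x t)) →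
      ∀ ε : ℝ, 0 < ε →
        ∃ m : ℕ, (m : ℝ) ≤ L * q ^ 2 / ε ∧
          ∃ g : PartialAssignment N, g.dom.card ≤ m ∧ SmallVariance F ε g) ∧
    (∃ (A : OracleRAM.Cmd) (timeBound queryBound : Polynomial ℝ) (C : ℝ),
      ∀ (N L q : ℕ) (F : (Fin N → Bool) → (Fin L → Bool)),
        (∀ t : Fin L, DTree.Computes q (fun x => F x t)) →
        ∀ ε δ : ℚ, 0 < ε → 0 < δ →
          ∃ T : ℕ,
            (T : ℝ) ≤ timeBound.eval ((N : ℝ) + L + q + 1 / ε + 1 / δ) ∧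
            (∀ ω : ℕ → Bool,
              (OracleRAM.run A F q ε δ ω T).1 = [] ∧
              ((OracleRAM.run A F q ε δ ω T).2.queries : ℝ) ≤
                L * N * queryBound.eval ((q : ℝ) / (δ * ε))) ∧
            ENNReal.ofReal (1 - δ) ≤ OracleRAM.coinMeasure {ω : ℕ → Bool |
              SmallVariance F ε (OracleRAM.output N (OracleRAM.run A F q ε δ ω T).2) ∧
              ((OracleRAM.output N (OracleRAM.run A F q ε δ ω T).2).dom.card : ℝ) ≤
                C * (L * q ^ 2 / (ε * δ))}) := by
  classical
  -- `2097152 = 2048 * 4 ^ 5`, because `⌈1 / ε⌉ * ⌈1 / δ⌉ ≤ 4 / (ε * δ)` when the search is run.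
  refine ⟨fun N L q F hF ε hε => ?_, OracleRAM.mainCmd,
    Polynomial.C 37000 * (Polynomial.X + Polynomial.C 3) ^ 13,
    Polynomial.C 2097152 * Polynomial.X ^ 5, 32, fun N L q F hF ε δ hε hδ => ?_⟩
  · obtain ⟨g, hg, hle⟩ := exists_smallVariance hF hε fun _ => none
    refine ⟨g.dom.card, ?_, g, le_rfl, hg⟩
    rw [card_dom_none, Nat.cast_zero, zero_mul, zero_add] at hle
    rw [le_div_iff₀ hε]
    have h1 : (q : ℝ) * potential F (fun _ => none) ≤ q * (L * q) :=
      mul_le_mul_of_nonneg_left (potential_le hF _) (Nat.cast_nonneg q)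
    have h2 : (0 : ℝ) ≤ q * potential F g := mul_nonneg (Nat.cast_nonneg q) (potential_nonneg g)
    nlinarith
  have hεr : (0 : ℝ) < ε := Rat.cast_pos.2 hε
  have hδr : (0 : ℝ) < δ := Rat.cast_pos.2 hδ
  set E := ⌈1 / ε⌉₊ with hEdef
  set D := ⌈1 / δ⌉₊ with hDdef
  have hE0 : 0 < E := Nat.ceil_pos.2 (by positivity)
  have hD0 : 0 < D := Nat.ceil_pos.2 (by positivity)
  have hEge : 1 / (ε : ℝ) ≤ E := by exact_mod_cast Nat.le_ceil (1 / ε)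
  have hDge : 1 / (δ : ℝ) ≤ D := by exact_mod_cast Nat.le_ceil (1 / δ)
  have hElt : (E : ℝ) < 1 / ε + 1 := by
    exact_mod_cast Nat.ceil_lt_add_one (show 0 ≤ 1 / ε by positivity)
  have hDlt : (D : ℝ) < 1 / δ + 1 := by
    exact_mod_cast Nat.ceil_lt_add_one (show 0 ≤ 1 / δ by positivity)
  have hεE : 1 / (E : ℝ) ≤ ε := by
    rw [div_le_iff₀ (by positivity)]
    rwa [div_le_iff₀ hεr, mul_comm] at hEge
  -- `X` dominates all parameters and exceeds the argument of the time bound by at most `3`.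
  obtain ⟨X, hX⟩ : ∃ X, X = N + L + q + E + D + 1 := ⟨_, rfl⟩
  have hT : ∀ T : ℕ, T ≤ 37000 * X ^ 13 → (T : ℝ) ≤
      (Polynomial.C 37000 * (Polynomial.X + Polynomial.C 3) ^ 13 : Polynomial ℝ).eval
        ((N : ℝ) + L + q + 1 / ε + 1 / δ) := by
    intro T hT
    simp only [Polynomial.eval_mul, Polynomial.eval_C, Polynomial.eval_pow, Polynomial.eval_add,
      Polynomial.eval_X]
    have h1 : (X : ℝ) ≤ (N : ℝ) + L + q + 1 / ε + 1 / δ + 3 := by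
      rw [hX]; push_cast; linarith
    calc (T : ℝ) ≤ ((37000 * X ^ 13 : ℕ) : ℝ) := Nat.cast_le.2 hT
      _ = 37000 * (X : ℝ) ^ 13 := by push_cast; ring
      _ ≤ _ := mul_le_mul_of_nonneg_left (pow_le_pow_left₀ (Nat.cast_nonneg X) h1 13)
        (by norm_num)
  have hX13 : ∀ T, T ≤ 37000 * X → T ≤ 37000 * X ^ 13 := fun T h =>
    h.trans (Nat.mul_le_mul_left _ (Nat.le_self_pow (by norm_num) X))
  have hQ0 : (0 : ℝ) ≤ L * N * (Polynomial.C 2097152 * Polynomial.X ^ 5 : Polynomial ℝ).eval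
      ((q : ℝ) / (δ * ε)) := by
    simp only [Polynomial.eval_mul, Polynomial.eval_C, Polynomial.eval_pow, Polynomial.eval_X]
    positivity
  have hC0 : (0 : ℝ) ≤ 32 * (L * q ^ 2 / (ε * δ)) := by positivity
  have hsim := fun ω => OracleRAM.sim_mainCmd (F := F) (s := OracleRAM.init N L q ε δ ω) (q := q)
    rfl rfl rfl (lt_ceil_iff hε) (lt_ceil_iff hδ) rfl
  rw [← hEdef, ← hDdef] at hsim
  by_cases htriv : q = 0 ∨ L = 0 ∨ E ≤ 1 ∨ D ≤ 1
  · obtain ⟨h1, h2⟩ := mainCmd_spec (fun _ : Unit => fun _ => none) (B := 0)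
      (C := 32 * (L * q ^ 2 / (ε * δ))) (fun ω => ((hsim ω).1 htriv).mono
        le_rfl le_rfl fun _ _ h => ⟨h, card_dom_none.le⟩)
      (by simpa using hC0) (by
        simp only [Coin.ex]
        split_ifs with hs
        · linarith
        rcases htriv with rfl | rfl | h | h
        · exact absurd (smallVariance_of_zero hF hεr.le _) hs
        · exact absurd (fun t : Fin 0 => t.elim0) hs
        · have : (E : ℝ) ≤ 1 := by exact_mod_cast h
          refine absurd (smallVariance_of_one_le ?_ _) hs
          have h1 := hEge.trans this
          rwa [div_le_iff₀ hεr, one_mul] at h1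
        · have : (D : ℝ) ≤ 1 := by exact_mod_cast h
          have h1 := hDge.trans this
          rw [div_le_iff₀ hδr, one_mul] at h1
          linarith)
    refine ⟨_, hT _ (hX13 _ (by omega)), fun ω => ⟨(h1 ω).1, ?_⟩, h2⟩
    rw [Nat.le_zero.1 (h1 ω).2, Nat.cast_zero]
    exact hQ0
  simp only [not_or, not_le] at htriv
  obtain ⟨hq0, hL0, hE1, hD1⟩ := htriv
  have hq : 0 < q := Nat.pos_of_ne_zero hq0
  have hL : 0 < L := Nat.pos_of_ne_zero hL0
  have hE2 : (E : ℝ) ≤ 2 * (1 / ε) := by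
    have : (1 : ℝ) < 1 / ε := by exact_mod_cast (Nat.lt_ceil.1 hE1)
    linarith
  have hD2 : (D : ℝ) ≤ 2 * (1 / δ) := by
    have : (1 : ℝ) < 1 / δ := by exact_mod_cast (Nat.lt_ceil.1 hD1)
    linarith
  have hED : (E : ℝ) * D ≤ 4 * (1 / (ε * δ)) := by
    calc (E : ℝ) * D ≤ 2 * (1 / ε) * (2 * (1 / δ)) := by gcongr
      _ = 4 * (1 / (ε * δ)) := by field_simp; norm_num
  by_cases hNL : N ≤ L
  · have hone : (1 : ℝ) ≤ 32 * (q ^ 2 / (ε * δ)) := by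
      have e1 : (1 : ℝ) ≤ E * D := by exact_mod_cast Nat.mul_pos hE0 hD0
      have e2 : (1 : ℝ) ≤ q ^ 2 := by exact_mod_cast Nat.pow_pos hq
      have e3 : (0 : ℝ) ≤ 1 / (ε * δ) := by positivity
      have e4 : (q : ℝ) ^ 2 / (ε * δ) = q ^ 2 * (1 / (ε * δ)) := by ring
      rw [e4]
      nlinarith
    obtain ⟨h1, h2⟩ := mainCmd_spec (fun _ : Unit => fun _ => some false) (B := N)
      (C := 32 * (L * q ^ 2 / (ε * δ)))
      (fun ω => ((hsim ω).2.1 hq hL hE1 hD1 hNL).mono le_rfl le_rfl fun _ _ h =>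
        ⟨h, card_dom_le _⟩) (by
        calc (N : ℝ) ≤ L := Nat.cast_le.2 hNL
          _ = L * 1 := (mul_one _).symm
          _ ≤ L * (32 * (q ^ 2 / (ε * δ))) := by gcongr
          _ = _ := by ring) (by
        simp only [Coin.ex, if_pos (smallVariance_of_total (F := F) hεr.le false)]
        linarith)
    refine ⟨_, hT _ (hX13 _ (by omega)), fun ω => ⟨(h1 ω).1, ?_⟩, h2⟩
    rw [Nat.le_zero.1 (h1 ω).2, Nat.cast_zero]
    exact hQ0
  have hN : 0 < N := by omega
  set K := 4 * (L * q ^ 2 * E * D) with hK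
  set n := Nat.clog 2 K with hn
  have hK1 : 1 < K := by
    have : 0 < L * q ^ 2 * E * D := by positivity
    omega
  have hKn : K ≤ 2 ^ n := Nat.le_pow_clog (by norm_num) K
  have hnK : 2 ^ n ≤ 2 * K := by
    have h1 := Nat.pow_pred_clog_lt_self (b := 2) (by norm_num) hK1
    have h2 : 0 < n := Nat.clog_pos (by norm_num) hK1
    rw [← hn] at h1
    have h3 : 2 ^ n = 2 ^ n.pred * 2 := by
      rw [← pow_succ, show n.pred + 1 = n from Nat.succ_pred_eq_of_pos h2]
    omega
  obtain ⟨h1, h2⟩ := mainCmd_spec id (B := 2 ^ n) (C := 32 * (L * q ^ 2 / (ε * δ)))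
    (fun ω => (hsim ω).2.2 hN hL hq hE1 hD1 (by omega) n rfl) (by
      calc ((2 ^ n : ℕ) : ℝ) ≤ ((2 * K : ℕ) : ℝ) := Nat.cast_le.2 hnK
        _ = 8 * (L * q ^ 2) * (E * D) := by rw [hK]; push_cast; ring
        _ ≤ 8 * (L * q ^ 2) * (4 * (1 / (ε * δ))) := by gcongr
        _ = _ := by ring) (by
      refine Coin.ex_search hF hN hL hq hE0 hεE ?_
      have e1 : (1 : ℝ) ≤ δ * D := by rwa [div_le_iff₀ hδr, mul_comm] at hDge
      have e2 : (K : ℝ) ≤ 2 ^ n := by exact_mod_cast hKn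
      calc (4 * L * q ^ 2 * E : ℝ) = 4 * L * q ^ 2 * E * 1 := (mul_one _).symm
        _ ≤ 4 * L * q ^ 2 * E * (δ * D) := by gcongr
        _ = δ * K := by rw [hK]; push_cast; ring
        _ ≤ δ * 2 ^ n := by gcongr)
  refine ⟨_, hT _ (time_bound hnK hX), fun ω => ⟨(h1 ω).1, ?_⟩, h2⟩
  simp only [Polynomial.eval_mul, Polynomial.eval_C, Polynomial.eval_pow, Polynomial.eval_X]
  calc _ ≤ ((L * N * (2048 * (q * E * D) ^ 5) : ℕ) : ℝ) :=
        Nat.cast_le.2 ((h1 ω).2.trans (query_bound hL hD0 (by omega) hnK))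
    _ = L * N * (2048 * (q * (E * D)) ^ 5) := by push_cast; ring
    _ ≤ L * N * (2048 * (q * (4 * (1 / (ε * δ)))) ^ 5) := by gcongr
    _ = _ := by ring
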